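/- Let $\mathbb{H}$ be the quaternions, $B(0,R)=\{q\in\mathbb{H}:|q|<R\}$, $\mathbb{B}=B(0,1)$, $\mathbb{S}=\{I\in\mathbb{H}: I^2=-1\}$, and for $I\in\mathbb{S}$ let $\mathbb{C}_I=\mathbb{R}+I\mathbb{R}$ and $\mathbb{B}_I=\mathbb{B}\cap\mathbb{C}_I$. A function $f:\mathbb{B}\to\mathbb{H}$ is slice regular if for every $I\in\mathbb{S}$ its restriction $f_I=f|_{\mathbb{B}_I}$ has continuous partial derivatives and satisfies $\frac12\big(\frac{\partial}{\partial x}+I\frac{\partial}{\partial y}\big)f_I(x+yI)=0$ on $\mathbb{B}_I$; its slice derivative is $f'(x+yI)=\frac12\big(\frac{\partial}{\partial x}-I\frac{\partial}{\partial y}\big)f_I(x+yI)$. For $p\in[1,\infty)$ the slice regular Bergman space $A^p(\mathbb{B})$ consists of the slice regular functions $f$ on $\mathbb{B}$ with $$\|f\|_{A^p}=\sup_{I\in\mathbb{S}}\Big(\int_{\mathbb{B}_I}|f_I(z)|^p\,d\sigma_I(z)\Big)^{1/p}<\infty,\qquad d\sigma_I(x+yI)=\tfrac1\pi\,dx\,dy.$$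 Theorem 1.3. Let $p\in[1,\infty)$ and let $f\in A^p(\mathbb{B})$ satisfy $f(0)=0$, $f'(0)=1$ and $\|f\|_{A^p}\le 1$. Then $f$ is injective on $B(0,r_p)$ and $B(0,R_p)\subset f\big(B(0,r_p)\big)$, where $$r_p=\sup_{0<r<1}\Big\{(1-r)^{-2/p}-\sqrt{(1-r)^{-4/p}-r^2}\Big\}$$ and $$R_p=\sup_{0<r<1}\Big\{r^{-2}(1-r)^{-2/p}\Big((1-r)^{-2/p}-\sqrt{(1-r)^{-4/p}-r^2}\Big)^2\Big\}.$$ -/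

import Mathlib

open MeasureTheory Metric Set
open scoped Quaternion ENNReal

namespace SliceRegular

/-- The sphere `𝕊` of imaginary units of the quaternions. -/
def imagUnits : Set ℍ := {q | q ^ 2 = -1}

/-- The parametrisation `x + y i ↦ x + y I` of the plane `ℂ_I = ℝ + I ℝ` by `ℂ`. -/
noncomputable def sliceMap (I : ℍ) (z : ℂ) : ℍ := (z.re : ℍ) + (z.im : ℍ) * I

/-- `Ω_I = Ω ∩ ℂ_I`, in the coordinate `z = x + y i`. -/
def slicePart (I : ℍ) (Ω : Set ℍ) : Set ℂ := {z | sliceMap I z ∈ Ω}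

/-- The restriction `f_I` of `f` to `ℂ_I`, in the coordinate `z = x + y i`. -/
noncomputable def sliceRestrict (I : ℍ) (f : ℍ → ℍ) (z : ℂ) : ℍ := f (sliceMap I z)

/-- `∂/∂x` of `f_I`. -/
noncomputable def partialX (I : ℍ) (f : ℍ → ℍ) (z : ℂ) : ℍ :=
  fderiv ℝ (sliceRestrict I f) z 1

/-- `∂/∂y` of `f_I`. -/
noncomputable def partialY (I : ℍ) (f : ℍ → ℍ) (z : ℂ) : ℍ :=
  fderiv ℝ (sliceRestrict I f) z Complex.I

/-- `∂̄_I f = (1/2) (∂/∂x + I ∂/∂y) f_I`. -/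
noncomputable def dbar (I : ℍ) (f : ℍ → ℍ) (z : ℂ) : ℍ :=
  (1 / 2 : ℝ) • (partialX I f z + I * partialY I f z)

/-- The `I`-derivative `∂_I f = (1/2) (∂/∂x - I ∂/∂y) f_I`. -/
noncomputable def derivAlong (I : ℍ) (f : ℍ → ℍ) (z : ℂ) : ℍ :=
  (1 / 2 : ℝ) • (partialX I f z - I * partialY I f z)

/-- Slice regularity on an open set `Ω`: every restriction `f_I`, `I ∈ 𝕊`, has continuous partial
derivatives on `Ω_I` and satisfies `∂̄_I f = 0` there. Only the values of `f` on `Ω` matter. -/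
def IsSliceRegularOn (f : ℍ → ℍ) (Ω : Set ℍ) : Prop :=
  ∀ I ∈ imagUnits, ContDiffOn ℝ 1 (sliceRestrict I f) (slicePart I Ω) ∧
    ∀ z ∈ slicePart I Ω, dbar I f z = 0

open Classical in
/-- An imaginary unit `I` with `q ∈ ℂ_I`: it is `Im q / |Im q|` if `q` is not real, and `i`
(an arbitrary choice) if `q` is real. -/
noncomputable def unitOf (q : ℍ) : ℍ :=
  if q.im = 0 then ((Complex.I : ℂ) : ℍ) else ‖q.im‖⁻¹ • q.im

/-- The coordinate `x + y i` of `q = x + y I` for `I = unitOf q`. -/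
noncomputable def coordOf (q : ℍ) : ℂ := ⟨q.re, ‖q.im‖⟩

/-- The slice derivative `f'`, given at `q = x + y I` by `∂_I f (x + y I)`. For slice regular `f`
it does not depend on the choice of `I`, see `sliceDeriv_sliceMap`. -/
noncomputable def sliceDeriv (f : ℍ → ℍ) (q : ℍ) : ℍ :=
  derivAlong (unitOf q) f (coordOf q)

/-- The normalised Lebesgue measure `dσ = (1/π) dx dy`. -/
noncomputable def normalizedArea : Measure ℂ := ENNReal.ofReal (1 / Real.pi) • volume

/-- The slice Bergman norm on the unit ball `𝔹`,
`sup_{I ∈ 𝕊} (∫_{𝔹_I} |f_I| ^ p dσ_I) ^ (1/p)`, with values in `[0, ∞]`. -/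
noncomputable def bergmanNorm (p : ℝ) (f : ℍ → ℍ) : ℝ≥0∞ :=
  ⨆ I ∈ imagUnits,
    (∫⁻ z in slicePart I (ball 0 1), ‖sliceRestrict I f z‖ₑ ^ p ∂normalizedArea) ^ (1 / p)

/-- The slice regular Bergman space `A^p(𝔹)` (of the second kind). -/
def bergmanSpace (p : ℝ) : Set (ℍ → ℍ) :=
  {f | IsSliceRegularOn f (ball 0 1) ∧ bergmanNorm p f < ∞}

/-- `(1 - r)^(-2/p) - √((1 - r)^(-4/p) - r²)`. -/
noncomputable def injTerm (p r : ℝ) : ℝ :=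
  (1 - r) ^ (-2 / p) - √((1 - r) ^ (-4 / p) - r ^ 2)

/-- `r⁻² (1 - r)^(-2/p) ((1 - r)^(-2/p) - √((1 - r)^(-4/p) - r²))²`. -/
noncomputable def covTerm (p r : ℝ) : ℝ :=
  (r ^ 2)⁻¹ * (1 - r) ^ (-2 / p) *
    ((1 - r) ^ (-2 / p) - √((1 - r) ^ (-4 / p) - r ^ 2)) ^ 2

/-- The radius `r_p`; the supremum is finite, see `isLUB_injRadius`. -/
noncomputable def injRadius (p : ℝ) : ℝ := sSup (injTerm p '' Ioo 0 1)

/-- The radius `R_p`; the supremum is finite, see `isLUB_covRadius`. -/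
noncomputable def covRadius (p : ℝ) : ℝ := sSup (covTerm p '' Ioo 0 1)

/-! ### The definitions are meaningful -/

theorem unitOf_mem (q : ℍ) : unitOf q ∈ imagUnits := by
  change unitOf q ^ 2 = -1
  by_cases h : q.im = 0
  · rw [unitOf, if_pos h, sq, ← Quaternion.coeComplex_mul, Complex.I_mul_I]
    ext <;> simp
  · have hn : ‖q.im‖ ≠ 0 := norm_ne_zero_iff.mpr h
    rw [unitOf, if_neg h, smul_pow, Quaternion.im_sq, Quaternion.normSq_eq_norm_mul_self,
      smul_neg, ← Quaternion.coe_smul, smul_eq_mul]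
    have : ‖q.im‖⁻¹ ^ 2 * (‖q.im‖ * ‖q.im‖) = 1 := by field_simp
    rw [this, Quaternion.coe_one]

theorem sliceMap_unitOf (q : ℍ) : sliceMap (unitOf q) (coordOf q) = q := by
  have key : (‖q.im‖ : ℍ) * unitOf q = q.im := by
    by_cases h : q.im = 0
    · rw [h, norm_zero, Quaternion.coe_zero, zero_mul]
    · have hn : ‖q.im‖ ≠ 0 := norm_ne_zero_iff.mpr h
      rw [unitOf, if_neg h, Quaternion.coe_mul_eq_smul, smul_smul, mul_inv_cancel₀ hn, one_smul]
  have : sliceMap (unitOf q) (coordOf q) = (q.re : ℍ) + (‖q.im‖ : ℍ) * unitOf q := rfl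
  rw [this, key, Quaternion.re_add_im]

theorem continuous_sliceMap (I : ℍ) : Continuous (sliceMap I) := by
  unfold sliceMap
  have h1 : Continuous fun z : ℂ => (z.re : ℍ) :=
    Quaternion.continuous_coe.comp Complex.continuous_re
  have h2 : Continuous fun z : ℂ => (z.im : ℍ) :=
    Quaternion.continuous_coe.comp Complex.continuous_im
  exact h1.add (h2.mul continuous_const)

theorem derivAlong_eq_deriv {f : ℍ → ℍ} {Ω : Set ℍ} (hΩ : IsOpen Ω) (hf : IsSliceRegularOn f Ω)
    {I : ℍ} (hI : I ∈ imagUnits) {z : ℂ} (hz : sliceMap I z ∈ Ω) :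
    derivAlong I f z = deriv (fun t : ℝ => f (sliceMap I z + (t : ℍ))) 0 := by
  obtain ⟨hc, hd⟩ := hf I hI
  have ho : IsOpen (slicePart I Ω) := hΩ.preimage (continuous_sliceMap I)
  have hda : DifferentiableAt ℝ (sliceRestrict I f) z :=
    (hc.contDiffAt (ho.mem_nhds hz)).differentiableAt (by simp)
  have h0 := hd z hz
  have h1 : I * partialY I f z = - partialX I f z := by
    have : partialX I f z + I * partialY I f z = 0 := by
      exact (smul_eq_zero.mp h0).resolve_left (by norm_num)
    exact eq_neg_of_add_eq_zero_right this
  have h2 : derivAlong I f z = partialX I f z := by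
    rw [derivAlong, h1, sub_neg_eq_add, ← two_smul ℝ, smul_smul]
    norm_num
  have hpath : HasDerivAt (fun t : ℝ => z + (t : ℂ)) 1 (0 : ℝ) :=
    (Complex.ofRealCLM.hasDerivAt (x := (0 : ℝ))).const_add z |>.congr_deriv (by simp)
  have hda' : HasFDerivAt (sliceRestrict I f) (fderiv ℝ (sliceRestrict I f) z)
      (z + ((0 : ℝ) : ℂ)) := by simpa using hda.hasFDerivAt
  have h3 := hda'.comp_hasDerivAt (0 : ℝ) hpath
  rw [h2]
  have h4 : (fun t : ℝ => f (sliceMap I z + (t : ℍ))) =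
      sliceRestrict I f ∘ fun t : ℝ => z + (t : ℂ) := by
    funext t
    simp only [Function.comp, sliceRestrict, sliceMap, Complex.add_re, Complex.add_im,
      Complex.ofReal_re, Complex.ofReal_im, add_zero, Quaternion.coe_add]
    rw [add_right_comm]
  rw [h4]
  exact h3.deriv.symm

/-- The slice derivative of a slice regular function is well defined: it is `∂_I f` on every
slice. -/
theorem sliceDeriv_sliceMap {f : ℍ → ℍ} {Ω : Set ℍ} (hΩ : IsOpen Ω) (hf : IsSliceRegularOn f Ω)
    {I : ℍ} (hI : I ∈ imagUnits) {z : ℂ} (hz : sliceMap I z ∈ Ω) :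
    sliceDeriv f (sliceMap I z) = derivAlong I f z := by
  rw [derivAlong_eq_deriv hΩ hf hI hz, sliceDeriv,
    derivAlong_eq_deriv hΩ hf (unitOf_mem _) (by rwa [sliceMap_unitOf]), sliceMap_unitOf]

theorem term_bounds {p r : ℝ} (hp : 1 ≤ p) (hr : r ∈ Ioo (0 : ℝ) 1) :
    0 < injTerm p r ∧ injTerm p r ≤ 1 ∧ 0 < covTerm p r ∧ covTerm p r ≤ 1 := by
  obtain ⟨h0, h1⟩ := hr
  have hp0 : 0 < p := by linarith
  have hM : 1 ≤ (1 - r) ^ (-2 / p) :=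
    Real.one_le_rpow_of_pos_of_le_one_of_nonpos (by linarith) (by linarith)
      (div_nonpos_of_nonpos_of_nonneg (by norm_num) hp0.le)
  have hM2 : (1 - r) ^ (-4 / p) = ((1 - r) ^ (-2 / p)) ^ 2 := by
    rw [← Real.rpow_natCast, ← Real.rpow_mul (by linarith)]
    congr 1
    push_cast
    ring
  unfold injTerm covTerm
  rw [hM2]
  set M := (1 - r) ^ (-2 / p)
  have hnn : 0 ≤ M ^ 2 - r ^ 2 := by nlinarith
  have hs := Real.sq_sqrt hnn
  have hs0 := Real.sqrt_nonneg (M ^ 2 - r ^ 2)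
  set s := √(M ^ 2 - r ^ 2)
  have hlt : s < M := by
    by_contra h
    push Not at h
    nlinarith
  have hprod : (M - s) * (M + s) = r ^ 2 := by nlinarith
  have hle : (M - s) * M ≤ r ^ 2 := by nlinarith
  have hle1 : M - s ≤ r ^ 2 := by nlinarith
  have hr2 : 0 < r ^ 2 := by positivity
  have hd : 0 < M - s := by linarith
  refine ⟨hd, by nlinarith, by positivity, ?_⟩
  have h3 : M * (M - s) ^ 2 ≤ r ^ 2 := by
    calc M * (M - s) ^ 2 = ((M - s) * M) * (M - s) := by ring
      _ ≤ r ^ 2 * 1 := mul_le_mul hle (by nlinarith) hd.le hr2.le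
      _ = r ^ 2 := mul_one _
  rw [mul_assoc, inv_mul_le_iff₀ hr2, mul_one]
  exact h3

theorem isLUB_injRadius {p : ℝ} (hp : 1 ≤ p) : IsLUB (injTerm p '' Ioo 0 1) (injRadius p) :=
  isLUB_csSup ((nonempty_Ioo.mpr one_pos).image _)
    ⟨1, by rintro _ ⟨r, hr, rfl⟩; exact (term_bounds hp hr).2.1⟩

theorem isLUB_covRadius {p : ℝ} (hp : 1 ≤ p) : IsLUB (covTerm p '' Ioo 0 1) (covRadius p) :=
  isLUB_csSup ((nonempty_Ioo.mpr one_pos).image _)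
    ⟨1, by rintro _ ⟨r, hr, rfl⟩; exact (term_bounds hp hr).2.2.2⟩

/-- In particular `B(0, r_p) ⊆ 𝔹`. -/
theorem injRadius_le_one {p : ℝ} (hp : 1 ≤ p) : injRadius p ≤ 1 :=
  (isLUB_injRadius hp).2 (by rintro _ ⟨r, hr, rfl⟩; exact (term_bounds hp hr).2.1)

end SliceRegular

/-! Write f = F + G j on ℂ, and let Fᶜ(z) = conj (F (conj z)). The representation formula attaches
to f the holomorphic matrix with rows (F, G) and (-Gᶜ, Fᶜ). If h q = z h with h = u + v j, then the
row (u, v) times this matrix at z gives the coordinates of h f(q). So each eigenvalue at z is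
conjugate to a value of f on the sphere through z, and bounds on f become bounds on eigenvalues. The
eigenvalues need not be holomorphic in z, but their symmetric functions, trace and determinant, are.

Suppose first that |f| < 1, f(0) = 0 and f'(0) = a ∈ (0, 1). For real t ∈ (0, 1) the product of (λ -
t)/(1 - tλ) over both eigenvalues λ is holomorphic, bounded by 1, and equal to t² at 0. If f takes
the value t at two points q ≠ q', this product is divisible by four linear factors with roots of
modulus |q|, |q|, |q'|, |q'|; removing Blaschke factors gives t ≤ |q||q'| (`real_value_le`). A right
unit factor makes any nonzero value real and positive, so |f(q)| ≤ |q||q'| at every collision.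
Schwarz–Pick on a slice gives |f(q)| ≥ ρ|q| for |q| ≤ ρ, where a(1 + ρ²) = 2ρ
(`mul_radius_le_norm`). The two bounds are incompatible inside B(0, ρ), whence injectivity. For
covering, the reciprocal product and the maximum principle show that no value of modulus below ρ² is
omitted on B(0, ρ) (`exists_value`).

In general, the mean value property and Hölder's inequality on slices give |f(q)| ≤ (1 -
|q|)^(-2/p). With M = (1 - r)^(-2/p), the function f(rq)/M falls under the first case with a = r/M.
Scaling back gives the radii rρ and Mρ², the two terms under the suprema. -/

namespace SliceRegular

open Filter Topology ComplexConjugate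

/-! ### Complex coordinates on the quaternions -/

/-- The component `α` of `q = α + β j`, with `α, β ∈ ℂ`. -/
noncomputable def fstCoord : ℍ →L[ℝ] ℂ :=
  LinearMap.toContinuousLinearMap
    { toFun := fun q => ⟨q.re, q.imI⟩
      map_add' := fun a b => by apply Complex.ext <;> simp
      map_smul' := fun r a => by apply Complex.ext <;> simp }

/-- The component `β` of `q = α + β j`, with `α, β ∈ ℂ`. -/
noncomputable def sndCoord : ℍ →L[ℝ] ℂ :=
  LinearMap.toContinuousLinearMap
    { toFun := fun q => ⟨q.imJ, q.imK⟩
      map_add' := fun a b => by apply Complex.ext <;> simp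
      map_smul' := fun r a => by apply Complex.ext <;> simp }

theorem fstCoord_apply (q : ℍ) : fstCoord q = ⟨q.re, q.imI⟩ := rfl

theorem sndCoord_apply (q : ℍ) : sndCoord q = ⟨q.imJ, q.imK⟩ := rfl

/-- The imaginary unit `j`. -/
def unitJ : ℍ := ⟨0, 0, 1, 0⟩

@[simp] theorem re_unitJ : unitJ.re = 0 := rfl

@[simp] theorem imI_unitJ : unitJ.imI = 0 := rfl

@[simp] theorem imJ_unitJ : unitJ.imJ = 1 := rfl

@[simp] theorem imK_unitJ : unitJ.imK = 0 := rfl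

theorem fst_add_snd_mul_unitJ (q : ℍ) : (fstCoord q : ℍ) + (sndCoord q : ℍ) * unitJ = q := by
  ext <;> simp [fstCoord_apply, sndCoord_apply]

theorem fstCoord_coe_mul (z : ℂ) (q : ℍ) : fstCoord (z * q) = z * fstCoord q := by
  apply Complex.ext <;> simp [fstCoord_apply]

theorem sndCoord_coe_mul (z : ℂ) (q : ℍ) : sndCoord (z * q) = z * sndCoord q := by
  apply Complex.ext <;> simp [sndCoord_apply]

theorem fstCoord_unitJ_mul (q : ℍ) : fstCoord (unitJ * q) = -conj (sndCoord q) := by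
  apply Complex.ext <;> simp [fstCoord_apply, sndCoord_apply]

theorem sndCoord_unitJ_mul (q : ℍ) : sndCoord (unitJ * q) = conj (fstCoord q) := by
  apply Complex.ext <;> simp [fstCoord_apply, sndCoord_apply]

theorem ext_coord {p q : ℍ} (h1 : fstCoord p = fstCoord q) (h2 : sndCoord p = sndCoord q) :
    p = q := by
  rw [← fst_add_snd_mul_unitJ p, h1, h2, fst_add_snd_mul_unitJ]

theorem unitJ_mul_coe (z : ℂ) : unitJ * (z : ℍ) = (conj z : ℂ) * unitJ := by
  ext <;> simp

theorem norm_coeComplex (z : ℂ) : ‖(z : ℍ)‖ = ‖z‖ := by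
  rw [← sq_eq_sq₀ (norm_nonneg _) (norm_nonneg _), sq, ← Quaternion.normSq_eq_norm_mul_self,
    ← Complex.normSq_eq_norm_sq, Quaternion.normSq_def', Complex.normSq_apply]
  simp; ring

theorem norm_fstCoord_le (q : ℍ) : ‖fstCoord q‖ ≤ ‖q‖ := by
  rw [← sq_le_sq₀ (norm_nonneg _) (norm_nonneg _), sq ‖q‖, ← Quaternion.normSq_eq_norm_mul_self,
    ← Complex.normSq_eq_norm_sq, Quaternion.normSq_def', Complex.normSq_apply, fstCoord_apply]
  nlinarith [sq_nonneg q.imJ, sq_nonneg q.imK]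

theorem imagUnits_mul_self {I : ℍ} (hI : I ∈ imagUnits) : I * I = -1 := by
  rw [← sq]; exact hI

theorem coe_I_mem_imagUnits : ((Complex.I : ℂ) : ℍ) ∈ imagUnits := by
  change ((Complex.I : ℂ) : ℍ) ^ 2 = -1
  rw [sq, ← Quaternion.coeComplex_mul, Complex.I_mul_I]
  ext <;> simp

theorem sliceMap_I (z : ℂ) : sliceMap ((Complex.I : ℂ) : ℍ) z = z := by
  ext <;> simp [sliceMap]

theorem sliceMap_ofReal (I : ℍ) (x : ℝ) : sliceMap I (x : ℂ) = (x : ℍ) := by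
  simp [sliceMap]

theorem sliceMap_ofReal_mul (I : ℍ) (r : ℝ) (z : ℂ) :
    sliceMap I (r * z) = (r : ℍ) * sliceMap I z := by
  simp [sliceMap, mul_add, mul_assoc]

theorem conj_sliceMap {I J h : ℍ} (hIJ : h * I = J * h) (z : ℂ) :
    h * sliceMap I z = sliceMap J z * h := by
  unfold sliceMap
  rw [mul_add, add_mul, mul_assoc, ← hIJ, ← mul_assoc, ← mul_assoc,
    ← Quaternion.coe_commutes, ← Quaternion.coe_commutes]

/-- Every imaginary unit is conjugate to `i`. -/
theorem exists_conj_I {K : ℍ} (hK : K ∈ imagUnits) :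
    ∃ h : ℍ, h ≠ 0 ∧ h * K = ((Complex.I : ℂ) : ℍ) * h := by
  have hI := imagUnits_mul_self coe_I_mem_imagUnits
  have hK := imagUnits_mul_self hK
  set i : ℍ := ((Complex.I : ℂ) : ℍ) with hi
  -- Since i² = K² = -1, the element 1 - iK intertwines K and i. It vanishes only for K = -i, where
  -- j serves instead.
  by_cases h0 : 1 - i * K = 0
  · have : K = -i := by
      have h1 : i * (1 - i * K) = 0 := by rw [h0, mul_zero]
      rw [mul_sub, mul_one, ← mul_assoc, hI, neg_one_mul, sub_neg_eq_add] at h1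
      exact eq_neg_of_add_eq_zero_right h1
    refine ⟨unitJ, ?_, ?_⟩
    · intro h
      have := congrArg QuaternionAlgebra.imJ h
      simp at this
    · rw [this, mul_neg, hi, unitJ_mul_coe]
      ext <;> simp
  · refine ⟨_, h0, ?_⟩
    rw [sub_mul, mul_sub, mul_assoc, hK, ← mul_assoc, hI]
    simp [add_comm]

/-- Every quaternion is conjugate to a complex number. -/
theorem exists_conj_coe (q : ℍ) : ∃ h : ℍ, h ≠ 0 ∧ h * q = (coordOf q : ℍ) * h := by
  obtain ⟨h, h0, hh⟩ := exists_conj_I (unitOf_mem q)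
  refine ⟨h, h0, ?_⟩
  have := conj_sliceMap hh (coordOf q)
  rwa [sliceMap_unitOf, sliceMap_I] at this

theorem norm_eq_of_conj {h q : ℍ} {z : ℂ} (h0 : h ≠ 0) (hq : h * q = z * h) : ‖q‖ = ‖z‖ := by
  have h1 := congrArg norm hq
  rw [norm_mul, norm_mul, norm_coeComplex, mul_comm ‖z‖] at h1
  exact mul_left_cancel₀ (norm_ne_zero_iff.mpr h0) h1

theorem norm_coordOf (q : ℍ) : ‖coordOf q‖ = ‖q‖ := by
  obtain ⟨h, h0, hh⟩ := exists_conj_coe q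
  exact (norm_eq_of_conj h0 hh).symm

theorem norm_sliceMap {I : ℍ} (hI : I ∈ imagUnits) (z : ℂ) : ‖sliceMap I z‖ = ‖z‖ := by
  obtain ⟨h, h0, hh⟩ := exists_conj_I hI
  refine norm_eq_of_conj h0 ?_
  rw [conj_sliceMap hh, sliceMap_I]

theorem slicePart_ball {I : ℍ} (hI : I ∈ imagUnits) (r : ℝ) :
    slicePart I (ball 0 r) = ball 0 r := by
  ext z
  simp [slicePart, norm_sliceMap hI]

/-! ### Holomorphy along slices -/

/-- Holomorphy on the unit disc of the scalar components of all restrictions `f_I`. -/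
def IsSliceHolomorphic (f : ℍ → ℍ) : Prop :=
  ∀ I ∈ imagUnits, ∀ L : ℍ →L[ℝ] ℂ, (∀ v, L (I * v) = Complex.I * L v) →
    DifferentiableOn ℂ (fun z => L (f (sliceMap I z))) (ball 0 1)

/-- The equation ∂̄_I f = 0 reads ∂f/∂y = I ∂f/∂x, and an L that carries left multiplication by I to
multiplication by i turns it into the Cauchy–Riemann equation. -/
theorem IsSliceRegularOn.isSliceHolomorphic {f : ℍ → ℍ} (hf : IsSliceRegularOn f (ball 0 1)) :
    IsSliceHolomorphic f := by
  intro I hI L hL z hz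
  obtain ⟨hc, hd⟩ := hf I hI
  rw [slicePart_ball hI] at hc hd
  have hda : DifferentiableAt ℝ (sliceRestrict I f) z :=
    (hc.contDiffAt (isOpen_ball.mem_nhds hz)).differentiableAt (by simp)
  have h0 : partialX I f z + I * partialY I f z = 0 :=
    (smul_eq_zero.mp (hd z hz)).resolve_left (by norm_num)
  have h1 : partialY I f z = I * partialX I f z := by
    rw [eq_neg_of_add_eq_zero_left h0, mul_neg, ← mul_assoc, imagUnits_mul_self hI]
    simp
  have hLd : HasFDerivAt (fun z => L (f (sliceMap I z)))
      (L.comp (fderiv ℝ (sliceRestrict I f) z)) z :=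
    L.hasFDerivAt.comp z hda.hasFDerivAt
  apply DifferentiableAt.differentiableWithinAt
  rw [differentiableAt_complex_iff_differentiableAt_real]
  refine ⟨hLd.differentiableAt, ?_⟩
  rw [hLd.fderiv, smul_eq_mul]
  change L (partialY I f z) = Complex.I * L (partialX I f z)
  rw [h1, hL]

/-- Real dilations preserve every slice, and right multiplication commutes with left multiplication
by I. These are the two normalisations used later. -/
theorem IsSliceHolomorphic.comp_mul {f : ℍ → ℍ} (hf : IsSliceHolomorphic f) {r : ℝ}
    (hr : r ∈ Ioc (0 : ℝ) 1) (m : ℍ) : IsSliceHolomorphic (fun q => f ((r : ℍ) * q) * m) := by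
  intro I hI L hL
  have h := hf I hI (L.comp (ContinuousLinearMap.mul ℝ ℍ |>.flip m)) (by
    intro v; simp [mul_assoc, hL])
  have h2 : DifferentiableOn ℂ (fun z : ℂ => (r : ℂ) * z) (ball 0 1) := by fun_prop
  have := h.comp h2 (fun z hz => by
    simp only [mem_ball_zero_iff] at hz ⊢
    rw [norm_mul, Complex.norm_real, Real.norm_of_nonneg hr.1.le]
    nlinarith [hr.2, norm_nonneg z])
  refine this.congr fun z _ => ?_
  simp [sliceMap_ofReal_mul]

theorem differentiableOn_conj_conj {F : ℂ → ℂ} (hF : DifferentiableOn ℂ F (ball 0 1)) :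
    DifferentiableOn ℂ (fun z => conj (F (conj z))) (ball 0 1) := by
  intro z hz
  have hz' : conj z ∈ ball (0 : ℂ) 1 := by simpa using hz
  have h1 := (hF _ hz').differentiableAt (isOpen_ball.mem_nhds hz')
  have := h1.conj_conj
  simp only [Complex.conj_conj] at this
  exact this.differentiableWithinAt

theorem eqOn_ball_of_eqOn_real {F G : ℂ → ℂ} (hF : DifferentiableOn ℂ F (ball 0 1))
    (hG : DifferentiableOn ℂ G (ball 0 1)) (h : ∀ x : ℝ, F x = G x) : EqOn F G (ball 0 1) := by
  refine AnalyticOnNhd.eqOn_of_preconnected_of_frequently_eq (𝕜 := ℂ) (z₀ := 0)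
    (hF.analyticOnNhd isOpen_ball) (hG.analyticOnNhd isOpen_ball)
    (convex_ball 0 1).isPreconnected (mem_ball_self one_pos) ?_
  have h1 : Tendsto (fun x : ℝ => (x : ℂ)) (𝓝[≠] 0) (𝓝[≠] 0) := by
    refine tendsto_nhdsWithin_iff.mpr ⟨?_, ?_⟩
    · exact (Complex.continuous_ofReal.tendsto' 0 0 (by simp)).mono_left nhdsWithin_le_nhds
    · filter_upwards [self_mem_nhdsWithin] with x hx
      simpa using hx
  exact h1.frequently (Eventually.frequently (Eventually.of_forall h))

/-- The representation formula: the values of `f` on the sphere through `ζ` are determined by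
`f ζ` and `f (conj ζ)`. -/
theorem IsSliceHolomorphic.representation {f : ℍ → ℍ} (hf : IsSliceHolomorphic f) {h q : ℍ} {z : ℂ}
    (h0 : h ≠ 0) (hq : h * q = z * h) (hz : ‖z‖ < 1) :
    h * f q = (fstCoord h : ℍ) * f z + (sndCoord h : ℍ) * (unitJ * f ((conj z : ℂ) : ℍ)) := by
  set i : ℍ := ((Complex.I : ℂ) : ℍ) with hi
  set u : ℂ := fstCoord h with hu
  set v : ℂ := sndCoord h with hv
  set K : ℍ := h⁻¹ * i * h with hKdef
  have hhK : h * K = i * h := by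
    rw [hKdef, ← mul_assoc, ← mul_assoc, mul_inv_cancel₀ h0, one_mul]
  have hK : K ∈ imagUnits := by
    change K ^ 2 = -1
    apply mul_left_cancel₀ h0
    rw [sq, ← mul_assoc, hhK, mul_assoc, hhK, ← mul_assoc, imagUnits_mul_self coe_I_mem_imagUnits]
    simp
  have hqK : q = sliceMap K z := by
    apply mul_left_cancel₀ h0
    rw [hq, conj_sliceMap hhK, sliceMap_I]
  -- With h and K fixed, both sides become holomorphic functions of z after applying L. They agree
  -- for real z, where the formula is h = u + v j times f(z), so the identity principle applies.
  have key : ∀ L : ℍ →L[ℝ] ℂ, (∀ v, L (i * v) = Complex.I * L v) →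
      L (h * f q) = L (u * f z + v * (unitJ * f ((conj z : ℂ) : ℍ))) := by
    intro L hL
    have d1 := hf K hK (L.comp (ContinuousLinearMap.mul ℝ ℍ h)) (by
      intro w; simp only [ContinuousLinearMap.comp_apply, ContinuousLinearMap.mul_apply']
      rw [← mul_assoc, hhK, mul_assoc, hL])
    have d2 := hf i coe_I_mem_imagUnits (L.comp (ContinuousLinearMap.mul ℝ ℍ u)) (by
      intro w; simp only [ContinuousLinearMap.comp_apply, ContinuousLinearMap.mul_apply']
      rw [← mul_assoc, hi, ← Quaternion.coeComplex_mul, mul_comm, Quaternion.coeComplex_mul,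
        mul_assoc, hL])
    -- Left multiplication by v j anticommutes with i, so it is conj ∘ L that gives a holomorphic
    -- function of f(z); reflecting it yields holomorphy of the term containing f (conj z).
    have d3 := differentiableOn_conj_conj <| hf i coe_I_mem_imagUnits
      ((Complex.conjCLE : ℂ →L[ℝ] ℂ).comp
        (L.comp (ContinuousLinearMap.mul ℝ ℍ ((v : ℍ) * unitJ)))) (by
      intro w; simp only [ContinuousLinearMap.comp_apply, ContinuousLinearMap.mul_apply']
      have : (v : ℍ) * unitJ * (i * w) = i * ((-1 : ℝ) • ((v : ℍ) * unitJ * w)) := by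
        have h1 : unitJ * i = - (i * unitJ) := by
          rw [hi, unitJ_mul_coe]; ext <;> simp
        have h2 : (v : ℍ) * i = i * v := by
          rw [hi, ← Quaternion.coeComplex_mul, mul_comm, Quaternion.coeComplex_mul]
        calc (v : ℍ) * unitJ * (i * w) = v * (unitJ * i) * w := by noncomm_ring
          _ = -((v * i) * unitJ * w) := by rw [h1]; noncomm_ring
          _ = _ := by rw [h2, neg_one_smul]; noncomm_ring
      rw [this, hL, L.map_smul]
      simp)
    have hmem : z ∈ ball (0 : ℂ) 1 := by simpa using hz
    have := eqOn_ball_of_eqOn_real d1 (d2.add d3) (by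
      intro x
      simp only [ContinuousLinearMap.comp_apply, ContinuousLinearMap.mul_apply', Pi.add_apply,
        Complex.conj_ofReal, sliceMap_ofReal, ContinuousLinearEquiv.coe_coe, Complex.conjCLE_apply,
        Complex.conj_conj]
      rw [← map_add, ← add_mul, hu, hv, fst_add_snd_mul_unitJ]) hmem
    simp only [ContinuousLinearMap.comp_apply, ContinuousLinearMap.mul_apply', Pi.add_apply,
        ContinuousLinearEquiv.coe_coe, Complex.conjCLE_apply, hi, sliceMap_I,
        Complex.conj_conj] at this
    rw [hqK, this, ← map_add, mul_assoc]
  exact ext_coord (key _ (fun w => fstCoord_coe_mul _ _)) (key _ (fun w => sndCoord_coe_mul _ _))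

/-! ### The characteristic polynomial of a slice function -/

theorem fstCoord_coe_add_coe_mul_unitJ (u v : ℂ) : fstCoord ((u : ℍ) + v * unitJ) = u := by
  apply Complex.ext <;> simp [fstCoord_apply]

theorem sndCoord_coe_add_coe_mul_unitJ (u v : ℂ) : sndCoord ((u : ℍ) + v * unitJ) = v := by
  apply Complex.ext <;> simp [sndCoord_apply]

/-- The component `F` of `f = F + G j` on `ℂ`. -/
noncomputable def fstPart (f : ℍ → ℍ) (z : ℂ) : ℂ := fstCoord (f z)

/-- The component `G` of `f = F + G j` on `ℂ`. -/
noncomputable def sndPart (f : ℍ → ℍ) (z : ℂ) : ℂ := sndCoord (f z)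

/-- The conjugate `z ↦ conj (F (conj z))` of a function on `ℂ`. -/
noncomputable def reflect (F : ℂ → ℂ) (z : ℂ) : ℂ := conj (F (conj z))

/-- The trace of `f` as a matrix-valued holomorphic function. -/
noncomputable def traceFun (f : ℍ → ℍ) (z : ℂ) : ℂ := fstPart f z + reflect (fstPart f) z

/-- The determinant of `f` as a matrix-valued holomorphic function: its symmetrization. -/
noncomputable def detFun (f : ℍ → ℍ) (z : ℂ) : ℂ :=
  fstPart f z * reflect (fstPart f) z + sndPart f z * reflect (sndPart f) z

section

variable {f : ℍ → ℍ}

theorem IsSliceHolomorphic.differentiableOn_fstPart (hf : IsSliceHolomorphic f) :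
    DifferentiableOn ℂ (fstPart f) (ball 0 1) := by
  have := hf _ coe_I_mem_imagUnits fstCoord (fun w => fstCoord_coe_mul _ _)
  simp only [sliceMap_I] at this
  exact this

theorem IsSliceHolomorphic.differentiableOn_sndPart (hf : IsSliceHolomorphic f) :
    DifferentiableOn ℂ (sndPart f) (ball 0 1) := by
  have := hf _ coe_I_mem_imagUnits sndCoord (fun w => sndCoord_coe_mul _ _)
  simp only [sliceMap_I] at this
  exact this

theorem differentiableOn_reflect {F : ℂ → ℂ} (hF : DifferentiableOn ℂ F (ball 0 1)) :
    DifferentiableOn ℂ (reflect F) (ball 0 1) :=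
  differentiableOn_conj_conj hF

theorem IsSliceHolomorphic.differentiableOn_traceFun (hf : IsSliceHolomorphic f) :
    DifferentiableOn ℂ (traceFun f) (ball 0 1) :=
  hf.differentiableOn_fstPart.add (differentiableOn_reflect hf.differentiableOn_fstPart)

theorem IsSliceHolomorphic.differentiableOn_detFun (hf : IsSliceHolomorphic f) :
    DifferentiableOn ℂ (detFun f) (ball 0 1) :=
  (hf.differentiableOn_fstPart.mul (differentiableOn_reflect hf.differentiableOn_fstPart)).add
    (hf.differentiableOn_sndPart.mul (differentiableOn_reflect hf.differentiableOn_sndPart))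

theorem IsSliceHolomorphic.fstCoord_mul (hf : IsSliceHolomorphic f) {h q : ℍ} {z : ℂ}
    (h0 : h ≠ 0) (hq : h * q = z * h) (hz : ‖z‖ < 1) :
    fstCoord (h * f q) =
      fstCoord h * fstPart f z - sndCoord h * reflect (sndPart f) z := by
  rw [hf.representation h0 hq hz, map_add, fstCoord_coe_mul, fstCoord_coe_mul, fstCoord_unitJ_mul,
    mul_neg, ← sub_eq_add_neg]
  rfl

theorem IsSliceHolomorphic.sndCoord_mul (hf : IsSliceHolomorphic f) {h q : ℍ} {z : ℂ}
    (h0 : h ≠ 0) (hq : h * q = z * h) (hz : ‖z‖ < 1) :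
    sndCoord (h * f q) =
      fstCoord h * sndPart f z + sndCoord h * reflect (fstPart f) z := by
  rw [hf.representation h0 hq hz, map_add, sndCoord_coe_mul, sndCoord_coe_mul, sndCoord_unitJ_mul]
  rfl

theorem exists_left_eigenvector {a b c d : ℂ} (h : a * d - b * c = 0) :
    ∃ u v : ℂ, (u ≠ 0 ∨ v ≠ 0) ∧ u * a + v * c = 0 ∧ u * b + v * d = 0 := by
  -- Up to sign, (d, -b) and (c, -a) are the rows of the adjugate; one of them is nonzero unless the
  -- matrix is zero.
  by_cases h1 : a = 0 ∧ c = 0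
  · by_cases h2 : b = 0 ∧ d = 0
    · exact ⟨1, 0, by simp, by simp [h1], by simp [h2]⟩
    · refine ⟨d, -b, ?_, by simp [h1], by ring⟩
      rw [neg_ne_zero]; tauto
  · refine ⟨c, -a, ?_, by ring, by linear_combination -h⟩
    rw [neg_ne_zero]; tauto

/-- Each eigenvalue of the matrix of `f` at `z` is, up to conjugation, a value of `f` on the sphere
through `z`. -/
theorem IsSliceHolomorphic.exists_value_of_root (hf : IsSliceHolomorphic f) {z l : ℂ}
    (hz : ‖z‖ < 1) (hl : l ^ 2 - traceFun f z * l + detFun f z = 0) :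
    ∃ q h : ℍ, ‖q‖ = ‖z‖ ∧ h ≠ 0 ∧ h * f q = l * h := by
  obtain ⟨u, v, h0, h1, h2⟩ := exists_left_eigenvector (a := fstPart f z - l)
    (b := sndPart f z) (c := -reflect (sndPart f) z)
    (d := reflect (fstPart f) z - l) (by
      rw [traceFun, detFun] at hl
      linear_combination hl)
  -- The left eigenvector, read as a quaternion, conjugates z to the point where f takes a value
  -- conjugate to l.
  set h : ℍ := (u : ℍ) + v * unitJ with hh
  have hu : fstCoord h = u := fstCoord_coe_add_coe_mul_unitJ u v
  have hv : sndCoord h = v := sndCoord_coe_add_coe_mul_unitJ u v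
  have hne : h ≠ 0 := by
    intro h'
    rw [h', map_zero] at hu hv
    rcases h0 with h0 | h0
    exacts [h0 hu.symm, h0 hv.symm]
  have hq : h * (h⁻¹ * z * h) = z * h := by
    rw [← mul_assoc, ← mul_assoc, mul_inv_cancel₀ hne, one_mul]
  refine ⟨h⁻¹ * z * h, h, norm_eq_of_conj hne hq, hne, ?_⟩
  apply ext_coord
  · rw [hf.fstCoord_mul hne hq hz, fstCoord_coe_mul, hu, hv]
    linear_combination h1
  · rw [hf.sndCoord_mul hne hq hz, sndCoord_coe_mul, hu, hv]
    linear_combination h2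

theorem exists_add_mul_eq (T N : ℂ) : ∃ l₁ l₂ : ℂ, l₁ + l₂ = T ∧ l₁ * l₂ = N := by
  obtain ⟨s, hs⟩ := IsAlgClosed.exists_pow_nat_eq (T ^ 2 - 4 * N) (n := 2) (by norm_num)
  refine ⟨(T + s) / 2, (T - s) / 2, by ring, ?_⟩
  linear_combination (-1 / 4) * hs

/-- The eigenvalues of the matrix of `f` at `z`. -/
theorem IsSliceHolomorphic.exists_eigenvalues (hf : IsSliceHolomorphic f) {z : ℂ} (hz : ‖z‖ < 1) :
    ∃ l₁ l₂ : ℂ, l₁ + l₂ = traceFun f z ∧ l₁ * l₂ = detFun f z ∧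
      (∃ q, ‖q‖ = ‖z‖ ∧ ‖l₁‖ = ‖f q‖) ∧ ∃ q, ‖q‖ = ‖z‖ ∧ ‖l₂‖ = ‖f q‖ := by
  obtain ⟨l₁, l₂, h1, h2⟩ :=
    exists_add_mul_eq (traceFun f z) (detFun f z)
  refine ⟨l₁, l₂, h1, h2, ?_, ?_⟩
  · obtain ⟨q, h, hq, h0, hh⟩ := hf.exists_value_of_root hz (l := l₁) (by rw [← h1, ← h2]; ring)
    exact ⟨q, hq, (norm_eq_of_conj h0 hh).symm⟩
  · obtain ⟨q, h, hq, h0, hh⟩ := hf.exists_value_of_root hz (l := l₂) (by rw [← h1, ← h2]; ring)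
    exact ⟨q, hq, (norm_eq_of_conj h0 hh).symm⟩

/-- The characteristic polynomial of `f`, evaluated at the real number `t`. -/
noncomputable def charFun (f : ℍ → ℍ) (t : ℝ) (z : ℂ) : ℂ :=
  t ^ 2 - traceFun f z * t + detFun f z

/-- The reversed characteristic polynomial of `f`, evaluated at the real number `t`. -/
noncomputable def charRevFun (f : ℍ → ℍ) (t : ℝ) (z : ℂ) : ℂ :=
  1 - traceFun f z * t + detFun f z * t ^ 2

theorem charFun_eq (f : ℍ → ℍ) (t : ℝ) (z : ℂ) :
    charFun f t z = (fstPart f z - t) * (reflect (fstPart f) z - t) +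
      sndPart f z * reflect (sndPart f) z := by
  rw [charFun, traceFun, detFun]; ring

theorem charFun_conj (f : ℍ → ℍ) (t : ℝ) (z : ℂ) :
    charFun f t (conj z) = conj (charFun f t z) := by
  simp only [charFun_eq, reflect, map_add, map_mul, map_sub, Complex.conj_conj, Complex.conj_ofReal]
  ring

theorem IsSliceHolomorphic.differentiableOn_charFun (hf : IsSliceHolomorphic f) (t : ℝ) :
    DifferentiableOn ℂ (charFun f t) (ball 0 1) :=
  ((hf.differentiableOn_traceFun.mul_const _).const_sub _).add hf.differentiableOn_detFun

theorem IsSliceHolomorphic.differentiableOn_charRevFun (hf : IsSliceHolomorphic f) (t : ℝ) :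
    DifferentiableOn ℂ (charRevFun f t) (ball 0 1) :=
  ((hf.differentiableOn_traceFun.mul_const _).const_sub _).add
    (hf.differentiableOn_detFun.mul_const _)

/-- A real t commutes with h, so the coordinates of h form a nonzero left null vector of the matrix
of f minus t, whose determinant is `charFun f t`. -/
theorem IsSliceHolomorphic.charFun_eq_zero (hf : IsSliceHolomorphic f) {h q : ℍ} {z : ℂ} {t : ℝ}
    (h0 : h ≠ 0) (hq : h * q = z * h) (hz : ‖z‖ < 1) (ht : f q = (t : ℍ)) :
    charFun f t z = 0 := by
  have e1 := hf.fstCoord_mul h0 hq hz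
  have e2 := hf.sndCoord_mul h0 hq hz
  rw [ht, ← Quaternion.coe_commutes, ← Quaternion.coeComplex_coe, fstCoord_coe_mul] at e1
  rw [ht, ← Quaternion.coe_commutes, ← Quaternion.coeComplex_coe, sndCoord_coe_mul] at e2
  have hne : fstCoord h ≠ 0 ∨ sndCoord h ≠ 0 := by
    by_contra! hc
    exact h0 (ext_coord (by simp [hc.1]) (by simp [hc.2]))
  rw [charFun_eq]
  rcases hne with hne | hne
  · apply mul_left_cancel₀ hne
    linear_combination (-(reflect (fstPart f) z - t)) * e1
      - reflect (sndPart f) z * e2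
  · apply mul_left_cancel₀ hne
    linear_combination sndPart f z * e1 - (fstPart f z - t) * e2

/-! ### Divisibility of holomorphic functions by polynomials -/

open Polynomial in
/-- Divisibility by a polynomial among holomorphic functions on the unit disc. -/
def DvdOnDisc (P : ℂ[X]) (D : ℂ → ℂ) : Prop :=
  ∃ H : ℂ → ℂ, DifferentiableOn ℂ H (ball 0 1) ∧ ∀ x ∈ ball (0 : ℂ) 1, D x = P.eval x * H x

section

open Polynomial

variable {P Q : ℂ[X]} {D E : ℂ → ℂ}

theorem dvdOnDisc_X_sub_C (hD : DifferentiableOn ℂ D (ball 0 1)) {a : ℂ} (ha : ‖a‖ < 1)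
    (h : D a = 0) : DvdOnDisc (X - C a) D := by
  refine ⟨dslope D a, (Complex.differentiableOn_dslope
    (isOpen_ball.mem_nhds (by simpa using ha))).mpr hD, fun x _ => ?_⟩
  have := sub_smul_dslope D a x
  rw [h, sub_zero, smul_eq_mul] at this
  simp [this]

theorem DvdOnDisc.add (hD : DvdOnDisc P D) (hE : DvdOnDisc P E) :
    DvdOnDisc P (fun z => D z + E z) := by
  obtain ⟨H, hH, h1⟩ := hD
  obtain ⟨K, hK, h2⟩ := hE
  exact ⟨fun z => H z + K z, hH.add hK, fun x hx => by
    simp only [h1 x hx, h2 x hx]; ring⟩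

theorem DvdOnDisc.mul (hD : DvdOnDisc P D) (hE : DvdOnDisc Q E) :
    DvdOnDisc (P * Q) (fun z => D z * E z) := by
  obtain ⟨H, hH, h1⟩ := hD
  obtain ⟨K, hK, h2⟩ := hE
  exact ⟨fun z => H z * K z, hH.mul hK,
    fun x hx => by simp only [h1 x hx, h2 x hx, eval_mul]; ring⟩

/-- If aP + bQ = 1, D = QK and D = PH, then D = aPD + bQD = PQ(aK + bH). -/
theorem DvdOnDisc.mul_of_isCoprime (hP : DvdOnDisc P D) (hQ : DvdOnDisc Q D)
    (h : IsCoprime P Q) : DvdOnDisc (P * Q) D := by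
  obtain ⟨H, hH, h1⟩ := hP
  obtain ⟨K, hK, h2⟩ := hQ
  obtain ⟨a, b, hab⟩ := h
  refine ⟨fun z => a.eval z * K z + b.eval z * H z,
    (a.differentiable.differentiableOn.mul hK).add (b.differentiable.differentiableOn.mul hH),
    fun x hx => ?_⟩
  have e := congrArg (eval x) hab
  simp only [eval_add, eval_mul, eval_one] at e ⊢
  have e1 := h1 x hx
  have e2 := h2 x hx
  linear_combination (-D x) * e + (b.eval x * Q.eval x) * e1 + (a.eval x * P.eval x) * e2

theorem isCoprime_X_sub_C {a b : ℂ} (h : a ≠ b) : IsCoprime (X - C a : ℂ[X]) (X - C b) :=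
  isCoprime_X_sub_C_of_isUnit_sub (sub_ne_zero.mpr h).isUnit

/-- The real polynomial vanishing on the sphere through `z`. -/
noncomputable def spherePoly (z : ℂ) : ℂ[X] := (X - C z) * (X - C (conj z))

theorem dvdOnDisc_spherePoly (hD : DifferentiableOn ℂ D (ball 0 1)) {z : ℂ} (hz : ‖z‖ < 1)
    (hne : z ≠ conj z) (h1 : D z = 0) (h2 : D (conj z) = 0) : DvdOnDisc (spherePoly z) D :=
  (dvdOnDisc_X_sub_C hD hz h1).mul_of_isCoprime (dvdOnDisc_X_sub_C hD (by simpa using hz) h2)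
    (isCoprime_X_sub_C hne)

/-- Divisibility of all four matrix entries gives the zero multiplicity that vanishing of the
determinant alone would not. -/
theorem dvdOnDisc_charFun (f : ℍ → ℍ) {t : ℝ} (h1 : DvdOnDisc P (fun z => fstPart f z - t))
    (h2 : DvdOnDisc Q (fun z => reflect (fstPart f) z - t)) (h3 : DvdOnDisc P (sndPart f))
    (h4 : DvdOnDisc Q (reflect (sndPart f))) : DvdOnDisc (P * Q) (charFun f t) := by
  have := (h1.mul h2).add (h3.mul h4)
  simp only [← charFun_eq] at this
  exact this

theorem coordOf_eq_conj {q : ℍ} (h : coordOf q = conj (coordOf q)) : q = coordOf q := by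
  obtain ⟨k, k0, hk⟩ := exists_conj_coe q
  obtain ⟨x, hx⟩ := Complex.conj_eq_iff_real.mp h.symm
  rw [hx, Quaternion.coeComplex_coe] at hk ⊢
  rw [Quaternion.coe_commutes] at hk
  exact mul_left_cancel₀ k0 hk

theorem fstPart_eq_of_eq {z : ℂ} {t : ℝ} (h : f z = (t : ℍ)) : fstPart f z = t := by
  rw [fstPart, h]; apply Complex.ext <;> simp [fstCoord_apply]

theorem sndPart_eq_of_eq {z : ℂ} {t : ℝ} (h : f z = (t : ℍ)) : sndPart f z = 0 := by
  rw [sndPart, h]; apply Complex.ext <;> simp [sndCoord_apply]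

/-- Off the real axis z and conj z are distinct zeros. At a real point every entry of the matrix
minus t vanishes, so the zero is double. -/
theorem IsSliceHolomorphic.dvdOnDisc_charFun (hf : IsSliceHolomorphic f) {q : ℍ} {t : ℝ}
    (hq : ‖q‖ < 1) (ht : f q = (t : ℍ)) :
    DvdOnDisc (spherePoly (coordOf q)) (charFun f t) := by
  have hz : ‖coordOf q‖ < 1 := by rwa [norm_coordOf]
  by_cases hne : coordOf q = conj (coordOf q)
  · have hqz := coordOf_eq_conj hne
    rw [spherePoly, ← hne]
    set z := coordOf q with hzdef
    have hfz : f z = (t : ℍ) := by rw [← hqz, ht]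
    have d1 := hf.differentiableOn_fstPart.sub_const (t : ℂ)
    have d2 := (differentiableOn_reflect hf.differentiableOn_fstPart).sub_const (t : ℂ)
    have d4 := differentiableOn_reflect hf.differentiableOn_sndPart
    refine SliceRegular.dvdOnDisc_charFun f (dvdOnDisc_X_sub_C d1 hz ?_)
      (dvdOnDisc_X_sub_C d2 hz ?_) (dvdOnDisc_X_sub_C hf.differentiableOn_sndPart hz ?_)
      (dvdOnDisc_X_sub_C d4 hz ?_)
    · simp [fstPart_eq_of_eq hfz]
    · simp [reflect, ← hne, fstPart_eq_of_eq hfz]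
    · simp [sndPart_eq_of_eq hfz]
    · simp [reflect, ← hne, sndPart_eq_of_eq hfz]
  · obtain ⟨k, k0, hk⟩ := exists_conj_coe q
    have h0 := hf.charFun_eq_zero k0 hk hz ht
    exact dvdOnDisc_spherePoly (hf.differentiableOn_charFun t) hz hne h0
      (by rw [charFun_conj, h0, map_zero])

/-- If `f` takes the same value at two points of a sphere, it is constant on this sphere. -/
theorem IsSliceHolomorphic.eq_of_coordOf_eq (hf : IsSliceHolomorphic f) {q q' w : ℍ}
    (hq : ‖q‖ < 1) (hne : q ≠ q') (hz : coordOf q = coordOf q') (h1 : f q = w)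
    (h2 : f q' = w) :
    f (coordOf q) = w ∧ f ((conj (coordOf q) : ℂ) : ℍ) = w := by
  obtain ⟨h, h0, hh⟩ := exists_conj_coe q
  obtain ⟨k, k0, hk⟩ := exists_conj_coe q'
  have hz1 : ‖coordOf q‖ < 1 := by rwa [norm_coordOf]
  rw [← hz] at hk
  set z := coordOf q
  have e1 := hf.representation h0 hh hz1
  have e2 := hf.representation k0 hk hz1
  rw [h1] at e1
  rw [h2] at e2
  set u := fstCoord h with hu
  set v := sndCoord h with hv
  set u' := fstCoord k with hu'
  set v' := sndCoord k with hv'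
  have hhe : h = u + v * unitJ := (fst_add_snd_mul_unitJ h).symm
  have hke : k = u' + v' * unitJ := (fst_add_snd_mul_unitJ k).symm
  -- If the rows were proportional, then k = c h with c ∈ ℂ; as c commutes with z, both h and k
  -- would conjugate z to the same point. Independent rows then force the column (A, B) to vanish.
  have hdet : u * v' - v * u' ≠ 0 := by
    intro hd
    have hc : ∃ c : ℂ, u' = c * u ∧ v' = c * v := by
      by_cases hu0 : u = 0
      · have hv0 : v ≠ 0 := by
          intro hv0
          apply h0
          rw [hhe, hu0, hv0]; simp
        refine ⟨v' / v, ?_, by field_simp⟩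
        rw [hu0, zero_mul, zero_sub, neg_eq_zero] at hd
        rw [hu0, mul_zero]
        exact (mul_eq_zero.mp hd).resolve_left hv0
      · refine ⟨u' / u, by field_simp, ?_⟩
        field_simp
        linear_combination hd
    obtain ⟨c, hc1, hc2⟩ := hc
    have hkc : k = c * h := by
      rw [hke, hhe, hc1, hc2, Quaternion.coeComplex_mul, Quaternion.coeComplex_mul]
      noncomm_ring
    have c0 : (c : ℍ) ≠ 0 := by
      rintro hc
      rw [hc, zero_mul] at hkc
      exact k0 hkc
    apply hne
    apply mul_left_cancel₀ k0
    have hcz : (z : ℍ) * c = c * z := by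
      rw [← Quaternion.coeComplex_mul, mul_comm, Quaternion.coeComplex_mul]
    rw [hk, hkc, mul_assoc, hh, ← mul_assoc, ← mul_assoc, hcz]
  set A := f z - w with hA
  set B := unitJ * (f ((conj z : ℂ) : ℍ) - w) with hB
  have e1' : (u : ℍ) * A + v * B = 0 := by
    have : (u : ℍ) * A + v * B =
      ((u : ℍ) * f z + v * (unitJ * f ((conj z : ℂ) : ℍ))) - (u + v * unitJ) * w := by
      rw [hA, hB]; noncomm_ring
    rw [this, ← e1, ← hhe, sub_self]
  have e2' : (u' : ℍ) * A + v' * B = 0 := by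
    have : (u' : ℍ) * A + v' * B =
      ((u' : ℍ) * f z + v' * (unitJ * f ((conj z : ℂ) : ℍ))) - (u' + v' * unitJ) * w := by
      rw [hA, hB]; noncomm_ring
    rw [this, ← e2, ← hke, sub_self]
  have solve : ∀ L : ℍ →L[ℝ] ℂ, (∀ (c : ℂ) x, L (c * x) = c * L x) → L A = 0 ∧ L B = 0 := by
    intro L hL
    have g1 := congrArg L e1'
    have g2 := congrArg L e2'
    rw [map_add, hL, hL, map_zero] at g1 g2
    exact ⟨mul_left_cancel₀ hdet (by linear_combination v' * g1 - v * g2),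
      mul_left_cancel₀ hdet (by linear_combination u * g2 - u' * g1)⟩
  have s1 := solve fstCoord fstCoord_coe_mul
  have s2 := solve sndCoord sndCoord_coe_mul
  have hA0 : A = 0 := ext_coord (by rw [s1.1, map_zero]) (by rw [s2.1, map_zero])
  have hB0 : B = 0 := ext_coord (by rw [s1.2, map_zero]) (by rw [s2.2, map_zero])
  refine ⟨sub_eq_zero.mp hA0, sub_eq_zero.mp ?_⟩
  refine (mul_eq_zero.mp hB0).resolve_left fun hj => ?_
  simpa using congrArg QuaternionAlgebra.imJ hj

/-- For two points of one sphere, f equals t at both z and conj z, so all matrix entries vanish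
there and the sphere polynomial occurs squared. For distinct spheres the two polynomials are
coprime. -/
theorem IsSliceHolomorphic.dvdOnDisc_charFun_of_ne (hf : IsSliceHolomorphic f) {q q' : ℍ} {t : ℝ}
    (hq : ‖q‖ < 1) (hq' : ‖q'‖ < 1) (hne : q ≠ q') (h1 : f q = (t : ℍ)) (h2 : f q' = (t : ℍ)) :
    DvdOnDisc (spherePoly (coordOf q) * spherePoly (coordOf q')) (charFun f t) := by
  by_cases hzz : coordOf q = coordOf q'
  · obtain ⟨e1, e2⟩ := hf.eq_of_coordOf_eq hq hne hzz h1 h2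
    have hz : ‖coordOf q‖ < 1 := by rwa [norm_coordOf]
    have hcz : coordOf q ≠ conj (coordOf q) := by
      intro hc
      apply hne
      rw [coordOf_eq_conj hc, hzz]
      rw [hzz] at hc
      exact (coordOf_eq_conj hc).symm
    rw [← hzz]
    set z := coordOf q with hzdef
    have d1 := hf.differentiableOn_fstPart.sub_const (t : ℂ)
    have d2 := (differentiableOn_reflect hf.differentiableOn_fstPart).sub_const (t : ℂ)
    have d4 := differentiableOn_reflect hf.differentiableOn_sndPart
    refine SliceRegular.dvdOnDisc_charFun f (dvdOnDisc_spherePoly d1 hz hcz ?_ ?_)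
      (dvdOnDisc_spherePoly d2 hz hcz ?_ ?_)
      (dvdOnDisc_spherePoly hf.differentiableOn_sndPart hz hcz ?_ ?_)
      (dvdOnDisc_spherePoly d4 hz hcz ?_ ?_) <;>
    simp [reflect, fstPart_eq_of_eq e1, fstPart_eq_of_eq e2, sndPart_eq_of_eq e1,
      sndPart_eq_of_eq e2]
  · refine (hf.dvdOnDisc_charFun hq h1).mul_of_isCoprime (hf.dvdOnDisc_charFun hq' h2) ?_
    -- Both coordinates lie in the closed upper half plane, so they can be conjugate only if they
    -- are equal.
    have aux : coordOf q ≠ conj (coordOf q') := by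
      intro h
      have him := congrArg Complex.im h
      rw [Complex.conj_im] at him
      have i1 : 0 ≤ (coordOf q).im := norm_nonneg _
      have i2 : 0 ≤ (coordOf q').im := norm_nonneg _
      apply hzz
      have hre := congrArg Complex.re h
      rw [Complex.conj_re] at hre
      exact Complex.ext hre (by linarith)
    unfold spherePoly
    refine IsCoprime.mul_left (IsCoprime.mul_right ?_ ?_) (IsCoprime.mul_right ?_ ?_) <;>
      apply isCoprime_X_sub_C
    · exact hzz
    · exact aux
    · intro h
      apply aux
      rw [← h, Complex.conj_conj]
    · intro h
      exact hzz ((starRingEnd ℂ).injective h)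

end

end

/-! ### Bounded holomorphic functions on the disc -/

theorem norm_sq_one_sub_mul_sub (a z : ℂ) :
    ‖1 - conj a * z‖ ^ 2 - ‖z - a‖ ^ 2 = (1 - ‖a‖ ^ 2) * (1 - ‖z‖ ^ 2) := by
  simp only [← Complex.normSq_eq_norm_sq, Complex.normSq_apply, Complex.sub_re, Complex.sub_im,
    Complex.mul_re, Complex.mul_im, Complex.conj_re, Complex.conj_im, Complex.one_re,
    Complex.one_im]
  ring

theorem norm_sub_le_norm_one_sub {a z : ℂ} (ha : ‖a‖ ≤ 1) (hz : ‖z‖ ≤ 1) :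
    ‖z - a‖ ≤ ‖1 - conj a * z‖ := by
  rw [← sq_le_sq₀ (norm_nonneg _) (norm_nonneg _)]
  have := norm_sq_one_sub_mul_sub a z
  have h1 : 0 ≤ 1 - ‖a‖ ^ 2 := by nlinarith [norm_nonneg a]
  have h2 : 0 ≤ 1 - ‖z‖ ^ 2 := by nlinarith [norm_nonneg z]
  nlinarith [mul_nonneg h1 h2]

theorem norm_one_sub_le_norm_sub {a z : ℂ} (ha : ‖a‖ ≤ 1) (hz : 1 ≤ ‖z‖) :
    ‖1 - conj a * z‖ ≤ ‖z - a‖ := by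
  rw [← sq_le_sq₀ (norm_nonneg _) (norm_nonneg _)]
  have := norm_sq_one_sub_mul_sub a z
  have h1 : 0 ≤ 1 - ‖a‖ ^ 2 := by nlinarith [norm_nonneg a]
  have h2 : 0 ≤ ‖z‖ ^ 2 - 1 := by nlinarith [norm_nonneg z]
  nlinarith [mul_nonneg h1 h2]

theorem one_sub_conj_mul_ne_zero {a z : ℂ} (ha : ‖a‖ < 1) (hz : ‖z‖ ≤ 1) :
    1 - conj a * z ≠ 0 := by
  intro h
  have h1 : ‖conj a * z‖ = 1 := by rw [← sub_eq_zero.mp h, norm_one]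
  rw [norm_mul, Complex.norm_conj] at h1
  nlinarith [norm_nonneg z, norm_nonneg a]

/-- Dividing a function bounded by `1` on the disc by a Blaschke factor keeps this bound. -/
theorem norm_blaschke_quotient_le {H : ℂ → ℂ} (hH : DifferentiableOn ℂ H (ball 0 1)) {a : ℂ}
    (ha : ‖a‖ < 1) (hb : ∀ x ∈ ball (0 : ℂ) 1, ‖(x - a) * H x‖ ≤ 1) :
    ∀ x ∈ ball (0 : ℂ) 1, ‖(1 - conj a * x) * H x‖ ≤ 1 := by
  intro x hx
  have hx1 : ‖x‖ < 1 := by simpa using hx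
  set K : ℂ → ℂ := fun x => (1 - conj a * x) * H x with hK
  have hKd : DifferentiableOn ℂ K (ball 0 1) := by
    refine DifferentiableOn.mul ?_ hH
    fun_prop
  -- On |y| = s the factors |1 - āy|² and |y - a|² differ by (1 - |a|²)(1 - s²), while |H y| ≤ 1/(s
  -- - |a|). The maximum principle carries the estimate to x, and the error tends to 0 as s → 1.
  have bound : ∀ s : ℝ, max ‖a‖ ‖x‖ < s → s < 1 →
      ‖K x‖ ^ 2 ≤ 1 + (1 - s ^ 2) / (s - ‖a‖) ^ 2 := by
    intro s hs hs1
    have has : ‖a‖ < s := (le_max_left _ _).trans_lt hs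
    have hxs : ‖x‖ < s := (le_max_right _ _).trans_lt hs
    have hs0 : 0 < s := (norm_nonneg _).trans_lt has
    have hd : DiffContOnCl ℂ K (ball 0 s) :=
      hKd.diffContOnCl_ball (closedBall_subset_ball hs1)
    have hC : 0 ≤ 1 + (1 - s ^ 2) / (s - ‖a‖) ^ 2 := by
      have : 0 ≤ 1 - s ^ 2 := by nlinarith
      positivity
    have := Complex.norm_le_of_forall_mem_frontier_norm_le isBounded_ball hd
      (C := √(1 + (1 - s ^ 2) / (s - ‖a‖) ^ 2)) (by
        intro y hy
        rw [frontier_ball _ hs0.ne', mem_sphere_zero_iff_norm] at hy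
        have hy1 : y ∈ ball (0 : ℂ) 1 := by simpa [hy] using hs1
        have hya : s - ‖a‖ ≤ ‖y - a‖ := by rw [← hy]; exact norm_sub_norm_le _ _
        have hsa : 0 < s - ‖a‖ := by linarith
        apply Real.le_sqrt_of_sq_le
        have h1 := hb y hy1
        have h2 := norm_sq_one_sub_mul_sub a y
        rw [norm_mul] at h1
        have h3 : ‖H y‖ ^ 2 * ‖y - a‖ ^ 2 ≤ 1 := by
          have := pow_le_one₀ (by positivity) h1 (n := 2)
          nlinarith
        have h4 : ‖H y‖ ^ 2 * (s - ‖a‖) ^ 2 ≤ 1 := by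
          refine le_trans ?_ h3
          gcongr
        have h5 : ‖H y‖ ^ 2 ≤ 1 / (s - ‖a‖) ^ 2 := by
          rw [le_div_iff₀ (by positivity)]; exact h4
        have h6 : 0 ≤ 1 - s ^ 2 := by nlinarith
        rw [hK]
        simp only
        rw [norm_mul, mul_pow]
        have h7 : ‖1 - conj a * y‖ ^ 2 = ‖y - a‖ ^ 2 + (1 - ‖a‖ ^ 2) * (1 - s ^ 2) := by
          rw [hy] at h2; linarith
        rw [h7, add_mul]
        have h8 : (1 - ‖a‖ ^ 2) * (1 - s ^ 2) * ‖H y‖ ^ 2 ≤ (1 - s ^ 2) * (1 / (s - ‖a‖) ^ 2) := by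
          have : (1 - ‖a‖ ^ 2) * (1 - s ^ 2) ≤ (1 - s ^ 2) := by nlinarith [sq_nonneg ‖a‖]
          exact mul_le_mul this h5 (by positivity) h6
        have h9 : (1 - s ^ 2) * (1 / (s - ‖a‖) ^ 2) = (1 - s ^ 2) / (s - ‖a‖) ^ 2 := by ring
        linarith)
      (subset_closure (by simpa using hxs))
    calc ‖K x‖ ^ 2 ≤ √(1 + (1 - s ^ 2) / (s - ‖a‖) ^ 2) ^ 2 := by gcongr
      _ = _ := Real.sq_sqrt hC
  have hlim : Tendsto (fun s : ℝ => 1 + (1 - s ^ 2) / (s - ‖a‖) ^ 2) (𝓝[<] 1) (𝓝 1) := by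
    have hc : ContinuousAt (fun s : ℝ => 1 + (1 - s ^ 2) / (s - ‖a‖) ^ 2) 1 := by
      have : (1 - ‖a‖) ^ 2 ≠ 0 := pow_ne_zero _ (by linarith)
      fun_prop (disch := assumption)
    have h2 := hc.tendsto
    norm_num at h2
    exact h2.mono_left nhdsWithin_le_nhds
  have : ‖K x‖ ^ 2 ≤ 1 := by
    refine ge_of_tendsto hlim ?_
    filter_upwards [Ioo_mem_nhdsLT (max_lt ha hx1)] with s hs
    exact bound s hs.1 hs.2
  exact (sq_le_one_iff₀ (norm_nonneg _)).mp this

/-- The factors x - a are exchanged one at a time for 1 - āx, which equals 1 at the origin. -/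
theorem norm_le_one_of_four_factors {H : ℂ → ℂ} (hH : DifferentiableOn ℂ H (ball 0 1))
    {a b c d : ℂ} (ha : ‖a‖ < 1) (hb : ‖b‖ < 1) (hc : ‖c‖ < 1) (hd : ‖d‖ < 1)
    (h : ∀ x ∈ ball (0 : ℂ) 1, ‖(x - a) * ((x - b) * ((x - c) * ((x - d) * H x)))‖ ≤ 1) :
    ‖H 0‖ ≤ 1 := by
  have d1 : DifferentiableOn ℂ (fun x => (x - b) * ((x - c) * ((x - d) * H x))) (ball 0 1) := by
    fun_prop
  have s1 := norm_blaschke_quotient_le d1 ha h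
  have d2 : DifferentiableOn ℂ (fun x => (1 - conj a * x) * ((x - c) * ((x - d) * H x)))
      (ball 0 1) := by fun_prop
  have s2 := norm_blaschke_quotient_le d2 hb fun x hx => (s1 x hx).trans' (by
    rw [mul_left_comm])
  have d3 : DifferentiableOn ℂ (fun x => (1 - conj b * x) * ((1 - conj a * x) * ((x - d) * H x)))
      (ball 0 1) := by fun_prop
  have s3 := norm_blaschke_quotient_le d3 hc fun x hx => (s2 x hx).trans' (by
    apply le_of_eq; congr 1; ring)
  have d4 : DifferentiableOn ℂ
      (fun x => (1 - conj c * x) * ((1 - conj b * x) * ((1 - conj a * x) * H x)))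
      (ball 0 1) := by fun_prop
  have s4 := norm_blaschke_quotient_le d4 hd fun x hx => (s3 x hx).trans' (by
    apply le_of_eq; congr 1; ring)
  simpa using s4 0 (mem_ball_self one_pos)

/-- A lower bound for bounded holomorphic functions, from the Schwarz–Pick lemma. -/
theorem mul_le_norm_of_deriv_eq {F : ℂ → ℂ} (hF : DifferentiableOn ℂ F (ball 0 1))
    (hb : ∀ x ∈ ball (0 : ℂ) 1, ‖F x‖ ≤ 1) (h0 : F 0 = 0) {a : ℝ} (ha : a ∈ Ioo (0 : ℝ) 1)
    (h1 : deriv F 0 = a) {z : ℂ} (hz : ‖z‖ < 1) :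
    ‖z‖ * (a - ‖z‖) ≤ ‖F z‖ * (1 - a * ‖z‖) := by
  set g := dslope F 0 with hg
  have hgd : DifferentiableOn ℂ g (ball 0 1) :=
    (Complex.differentiableOn_dslope (isOpen_ball.mem_nhds (mem_ball_self one_pos))).mpr hF
  have hgb : ∀ x ∈ ball (0 : ℂ) 1, ‖g x‖ ≤ 1 := by
    intro x hx
    have := Complex.norm_dslope_le_div_of_mapsTo_ball (R₂ := 1) hF
      (fun y hy => by simpa [h0] using hb y hy) hx
    simpa using this
  have hg0 : g 0 = a := by rw [hg, dslope_same, h1]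
  have hFz : F z = z * g z := by
    have := sub_smul_dslope F 0 z
    rw [h0, sub_zero, sub_zero, smul_eq_mul] at this
    exact this.symm
  have han : ‖(a : ℂ)‖ < 1 := by
    rw [Complex.norm_real, Real.norm_of_nonneg ha.1.le]; exact ha.2
  have hne : ∀ x ∈ ball (0 : ℂ) 1, 1 - (a : ℂ) * g x ≠ 0 := fun x hx => by
    simpa using one_sub_conj_mul_ne_zero han (hgb x hx)
  -- g = F(z)/z is bounded by 1 with g(0) = a; a disc automorphism moves a to 0, and the Schwarz
  -- lemma applies.
  have hφd : DifferentiableOn ℂ (fun x => (g x - a) / (1 - a * g x)) (ball 0 1) :=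
    (hgd.sub_const _).div ((hgd.const_mul _).const_sub _) hne
  have hzb : z ∈ ball (0 : ℂ) 1 := by simpa using hz
  have hS := Complex.dist_le_div_mul_dist_of_mapsTo_ball (R₂ := 1) hφd (by
    intro x hx
    have := norm_sub_le_norm_one_sub han.le (hgb x hx)
    rw [Complex.conj_ofReal] at this
    simp only [hg0, sub_self, zero_div, mem_closedBall_zero_iff, norm_div]
    exact div_le_one_of_le₀ this (norm_nonneg _)) hzb
  simp only [hg0, sub_self, zero_div, dist_zero_right, norm_div, div_one, one_mul] at hS
  rw [div_le_iff₀ (norm_pos_iff.mpr (hne z hzb))] at hS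
  have hgz := hgb z hzb
  have hre := Complex.re_le_norm (g z)
  have hsq : ‖g z - a‖ ^ 2 ≤ ‖z‖ ^ 2 * ‖1 - a * g z‖ ^ 2 := by
    rw [← mul_pow]; gcongr
  have e1 : ‖g z - a‖ ^ 2 = ‖g z‖ ^ 2 - 2 * a * (g z).re + a ^ 2 := by
    simp only [← Complex.normSq_eq_norm_sq, Complex.normSq_apply, Complex.sub_re, Complex.sub_im,
      Complex.ofReal_re, Complex.ofReal_im]
    ring
  have e2 : ‖1 - a * g z‖ ^ 2 = 1 - 2 * a * (g z).re + a ^ 2 * ‖g z‖ ^ 2 := by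
    simp only [← Complex.normSq_eq_norm_sq, Complex.normSq_apply, Complex.sub_re, Complex.sub_im,
      Complex.mul_re, Complex.mul_im, Complex.ofReal_re, Complex.ofReal_im, Complex.one_re,
      Complex.one_im]
    ring
  rw [e1, e2] at hsq
  rw [hFz, norm_mul, mul_assoc]
  refine mul_le_mul_of_nonneg_left ?_ (norm_nonneg z)
  set s := ‖g z‖
  set x := ‖z‖
  have hx0 : 0 ≤ x := norm_nonneg z
  have hs0 : 0 ≤ s := norm_nonneg _
  have hx2 : 0 ≤ 1 - x ^ 2 := by nlinarith
  -- Replacing Re g(z) by |g(z)| only weakens the inequality: the extremal case has g(z) real and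
  -- nonnegative.
  have hq : (a - s) ^ 2 ≤ (x * (1 - a * s)) ^ 2 := by
    have := mul_le_mul_of_nonneg_left hre (mul_nonneg (mul_nonneg zero_le_two ha.1.le) hx2)
    nlinarith
  have has : 0 ≤ 1 - a * s := by nlinarith [ha.1, ha.2]
  have := abs_le_of_sq_le_sq hq (mul_nonneg hx0 has)
  nlinarith [(abs_le.mp this).2]

/-! ### Injectivity and covering on the unit ball -/

variable {f : ℍ → ℍ}

theorem traceFun_zero (h0 : f 0 = 0) : traceFun f 0 = 0 := by
  simp [traceFun, reflect, fstPart, h0]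

theorem detFun_zero (h0 : f 0 = 0) : detFun f 0 = 0 := by
  simp [detFun, reflect, fstPart, sndPart, h0]

theorem IsSliceHolomorphic.exists_charFun_eq (hf : IsSliceHolomorphic f) {z : ℂ} (hz : ‖z‖ < 1)
    (t : ℝ) : ∃ l₁ l₂ : ℂ, charFun f t z = (l₁ - t) * (l₂ - t) ∧
      charRevFun f t z = (1 - conj (t : ℂ) * l₁) * (1 - conj (t : ℂ) * l₂) ∧
      (∃ q, ‖q‖ = ‖z‖ ∧ ‖l₁‖ = ‖f q‖) ∧ ∃ q, ‖q‖ = ‖z‖ ∧ ‖l₂‖ = ‖f q‖ := by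
  obtain ⟨l₁, l₂, h1, h2, h3, h4⟩ := hf.exists_eigenvalues hz
  refine ⟨l₁, l₂, ?_, ?_, h3, h4⟩
  · rw [charFun, ← h1, ← h2]; ring
  · rw [charRevFun, ← h1, ← h2, Complex.conj_ofReal]; ring

/-- `charFun` over `charRevFun` is the product of the Blaschke factors of the two eigenvalues. It is
bounded by 1 and equals t² at 0, and its four zeros bound that value by (|q||q'|)². -/
theorem IsSliceHolomorphic.real_value_le (hf : IsSliceHolomorphic f)
    (hb : ∀ q, ‖q‖ < 1 → ‖f q‖ ≤ 1) (h0 : f 0 = 0) {q q' : ℍ} {t : ℝ} (ht : t ∈ Ioo (0 : ℝ) 1)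
    (hq : ‖q‖ < 1) (hq' : ‖q'‖ < 1) (hne : q ≠ q') (h1 : f q = (t : ℍ)) (h2 : f q' = (t : ℍ)) :
    t ≤ ‖q‖ * ‖q'‖ := by
  obtain ⟨H, hH, hD⟩ := hf.dvdOnDisc_charFun_of_ne hq hq' hne h1 h2
  have htn : ‖(t : ℂ)‖ < 1 := by
    rw [Complex.norm_real, Real.norm_of_nonneg ht.1.le]; exact ht.2
  have hEne : ∀ x ∈ ball (0 : ℂ) 1, charRevFun f t x ≠ 0 := by
    intro x hx
    have hx1 : ‖x‖ < 1 := by simpa using hx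
    obtain ⟨l₁, l₂, -, e, ⟨p, hp, hl⟩, ⟨p', hp', hl'⟩⟩ := hf.exists_charFun_eq hx1 t
    rw [e]
    exact mul_ne_zero (one_sub_conj_mul_ne_zero htn (hl ▸ hb p (hp ▸ hx1)))
      (one_sub_conj_mul_ne_zero htn (hl' ▸ hb p' (hp' ▸ hx1)))
  have hle : ∀ x ∈ ball (0 : ℂ) 1, ‖charFun f t x / charRevFun f t x‖ ≤ 1 := by
    intro x hx
    have hx1 : ‖x‖ < 1 := by simpa using hx
    obtain ⟨l₁, l₂, e', e, ⟨p, hp, hl⟩, ⟨p', hp', hl'⟩⟩ := hf.exists_charFun_eq hx1 t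
    rw [norm_div]
    refine div_le_one_of_le₀ ?_ (norm_nonneg _)
    rw [e, e', norm_mul, norm_mul]
    exact mul_le_mul (norm_sub_le_norm_one_sub htn.le (hl ▸ hb p (hp ▸ hx1)))
      (norm_sub_le_norm_one_sub htn.le (hl' ▸ hb p' (hp' ▸ hx1))) (norm_nonneg _) (norm_nonneg _)
  set z := coordOf q
  set z' := coordOf q'
  have hz : ‖z‖ = ‖q‖ := norm_coordOf q
  have hz' : ‖z'‖ = ‖q'‖ := norm_coordOf q'
  have hfac : ∀ x ∈ ball (0 : ℂ) 1, charFun f t x / charRevFun f t x =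
      (x - z) * ((x - conj z) * ((x - z') * ((x - conj z') * (H x / charRevFun f t x)))) := by
    intro x hx
    rw [hD x hx]
    simp only [spherePoly, Polynomial.eval_mul, Polynomial.eval_sub, Polynomial.eval_X,
      Polynomial.eval_C]
    ring
  have hH0 := norm_le_one_of_four_factors (H := fun x => H x / charRevFun f t x)
    (hH.div (hf.differentiableOn_charRevFun t) hEne) (a := z) (b := conj z) (c := z')
    (d := conj z') (by rwa [hz]) (by rwa [Complex.norm_conj, hz]) (by rwa [hz'])
    (by rwa [Complex.norm_conj, hz']) fun x hx => by rw [← hfac x hx]; exact hle x hx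
  have hval := congrArg norm (hfac 0 (mem_ball_self one_pos))
  have hc0 : charFun f t 0 = (t : ℂ) ^ 2 := by
    rw [charFun, traceFun_zero h0, detFun_zero h0]; ring
  have hr0 : charRevFun f t 0 = 1 := by
    rw [charRevFun, traceFun_zero h0, detFun_zero h0]; ring
  simp only [zero_sub, norm_mul, norm_neg, Complex.norm_conj, hz, hz', hc0] at hval
  rw [hr0, div_one, norm_pow, Complex.norm_real, Real.norm_of_nonneg ht.1.le] at hval
  rw [hr0] at hH0
  have hsq : t ^ 2 ≤ (‖q‖ * ‖q'‖) ^ 2 := by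
    rw [hval]
    have : (0 : ℝ) ≤ (‖q‖ * ‖q'‖) ^ 2 := by positivity
    nlinarith
  exact (sq_le_sq₀ ht.1.le (by positivity)).mp hsq

theorem IsSliceHolomorphic.mul_right (hf : IsSliceHolomorphic f) (m : ℍ) :
    IsSliceHolomorphic (fun q => f q * m) := by
  simpa using hf.comp_mul (r := 1) ⟨one_pos, le_rfl⟩ m

/-- If a bounded slice function vanishing at `0` takes a value twice, this value is small. -/
theorem IsSliceHolomorphic.norm_value_le (hf : IsSliceHolomorphic f)
    (hb : ∀ q, ‖q‖ < 1 → ‖f q‖ < 1) (h0 : f 0 = 0) {q q' : ℍ}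
    (hq : ‖q‖ < 1) (hq' : ‖q'‖ < 1) (hne : q ≠ q') (h : f q = f q') :
    ‖f q‖ ≤ ‖q‖ * ‖q'‖ := by
  by_cases hw : f q = 0
  · rw [hw, norm_zero]; positivity
  have hwn : ‖f q‖ ≠ 0 := norm_ne_zero_iff.mpr hw
  -- Right multiplication by this unit quaternion makes the common value real and positive.
  set m : ℍ := (f q)⁻¹ * (‖f q‖ : ℝ) with hm
  have hmn : ‖m‖ = 1 := by
    rw [hm, norm_mul, norm_inv, Quaternion.norm_coe, norm_norm, inv_mul_cancel₀ hwn]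
  have hqm : f q * m = ((‖f q‖ : ℝ) : ℍ) := by
    rw [hm, ← mul_assoc, mul_inv_cancel₀ hw, one_mul]
  refine (hf.mul_right m).real_value_le (fun p hp => ?_) ?_
    ⟨(norm_nonneg _).lt_of_ne hwn.symm, hb q hq⟩ hq hq' hne hqm (by rw [← h, hqm])
  · rw [norm_mul, hmn, mul_one]; exact (hb p hp).le
  · rw [h0, zero_mul]

/-- If t were omitted, `charRevFun` over `charFun` would be holomorphic on the closed disc of radius
ρ. On the boundary the eigenvalues have modulus at least 1, so the quotient is bounded by 1 there,
yet at 0 it equals 1/t² > 1. -/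
theorem IsSliceHolomorphic.exists_real_value (hf : IsSliceHolomorphic f) {ρ : ℝ}
    (hρ : ρ ∈ Ioo (0 : ℝ) 1) (hb : ∀ q, ‖q‖ = ρ → 1 ≤ ‖f q‖) (h0 : f 0 = 0) {t : ℝ}
    (ht : t ∈ Ioo (0 : ℝ) 1) : ∃ q, ‖q‖ < ρ ∧ f q = (t : ℍ) := by
  by_contra! hc
  have htn : ‖(t : ℂ)‖ < 1 := by
    rw [Complex.norm_real, Real.norm_of_nonneg ht.1.le]; exact ht.2
  have hne : ∀ x ∈ closedBall (0 : ℂ) ρ, charFun f t x ≠ 0 := by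
    intro x hx h
    have hx1 : ‖x‖ ≤ ρ := by simpa using hx
    have hx2 : ‖x‖ < 1 := hx1.trans_lt hρ.2
    rcases hx1.lt_or_eq with hx1 | hx1
    · obtain ⟨q, k, hq, k0, hk⟩ := hf.exists_value_of_root hx2 (l := t) h
      refine hc q (hq ▸ hx1) (mul_left_cancel₀ k0 ?_)
      rw [hk, Quaternion.coeComplex_coe, Quaternion.coe_commutes]
    · obtain ⟨l₁, l₂, e', e, ⟨p, hp, hl⟩, ⟨p', hp', hl'⟩⟩ := hf.exists_charFun_eq hx2 t
      have aux : ∀ l : ℂ, 1 ≤ ‖l‖ → l - t ≠ 0 := by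
        intro l hl h
        rw [sub_eq_zero.mp h] at hl
        linarith
      rw [e'] at h
      exact mul_ne_zero (aux l₁ (hl ▸ hb p (hp.trans hx1))) (aux l₂ (hl' ▸ hb p' (hp'.trans hx1))) h
  have hsub : closedBall (0 : ℂ) ρ ⊆ ball 0 1 := closedBall_subset_ball hρ.2
  have hd : DifferentiableOn ℂ (fun x => charRevFun f t x / charFun f t x) (closedBall 0 ρ) :=
    ((hf.differentiableOn_charRevFun t).mono hsub).div
      ((hf.differentiableOn_charFun t).mono hsub) hne
  have hcl : DiffContOnCl ℂ (fun x => charRevFun f t x / charFun f t x) (ball 0 ρ) :=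
    hd.diffContOnCl_ball subset_rfl
  have := Complex.norm_le_of_forall_mem_frontier_norm_le isBounded_ball hcl (C := 1) (by
      intro x hx
      rw [frontier_ball _ hρ.1.ne', mem_sphere_zero_iff_norm] at hx
      obtain ⟨l₁, l₂, e', e, ⟨p, hp, hl⟩, ⟨p', hp', hl'⟩⟩ :=
        hf.exists_charFun_eq (hx.trans_lt hρ.2) t
      rw [norm_div]
      refine div_le_one_of_le₀ ?_ (norm_nonneg _)
      rw [e, e', norm_mul, norm_mul]
      exact mul_le_mul (norm_one_sub_le_norm_sub htn.le (hl ▸ hb p (hp.trans hx)))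
        (norm_one_sub_le_norm_sub htn.le (hl' ▸ hb p' (hp'.trans hx))) (norm_nonneg _)
        (norm_nonneg _)) (subset_closure (mem_ball_self hρ.1))
  simp only [charFun, charRevFun, traceFun_zero h0, detFun_zero h0] at this
  simp only [zero_mul, sub_zero, add_zero, norm_div, norm_one, norm_pow, Complex.norm_real,
    Real.norm_of_nonneg ht.1.le] at this
  rw [div_le_one (by have := ht.1; positivity)] at this
  nlinarith [ht.1, ht.2]

/-- A slice function vanishing at `0` that is at least `c` on a sphere covers the ball of radius
`c`. -/
theorem IsSliceHolomorphic.exists_value (hf : IsSliceHolomorphic f) {ρ c : ℝ}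
    (hρ : ρ ∈ Ioo (0 : ℝ) 1) (hb : ∀ q, ‖q‖ = ρ → c ≤ ‖f q‖) (h0 : f 0 = 0) {w : ℍ}
    (hw : ‖w‖ < c) : ∃ q, ‖q‖ < ρ ∧ f q = w := by
  by_cases hw0 : w = 0
  · exact ⟨0, by simpa using hρ.1, by rw [h0, hw0]⟩
  have hwn : 0 < ‖w‖ := norm_pos_iff.mpr hw0
  have hc : 0 < c := hwn.trans hw
  set t : ℝ := ‖w‖ / c with ht
  have ht0 : 0 < t := div_pos hwn hc
  -- This factor has norm 1/c: it sends w to the real number t < 1 and normalises the lower bound on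
  -- the sphere to 1.
  set m : ℍ := w⁻¹ * (t : ℍ) with hm
  have hm0 : m ≠ 0 := mul_ne_zero (inv_ne_zero hw0) (by
    rw [← norm_ne_zero_iff, Quaternion.norm_coe, Real.norm_of_nonneg ht0.le]; exact ht0.ne')
  have hmn : ‖m‖ = c⁻¹ := by
    rw [hm, norm_mul, norm_inv, Quaternion.norm_coe, Real.norm_of_nonneg ht0.le, ht]
    field_simp
  obtain ⟨q, hq, hqt⟩ := (hf.mul_right m).exists_real_value hρ (fun q hq => by
    rw [norm_mul, hmn, ← div_eq_mul_inv, le_div_iff₀ hc, one_mul]; exact hb q hq)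
    (by rw [h0, zero_mul]) (t := t) ⟨ht0, (div_lt_one hc).mpr hw⟩
  refine ⟨q, hq, mul_right_cancel₀ hm0 ?_⟩
  rw [hqt, hm, ← mul_assoc, mul_inv_cancel₀ hw0, one_mul]

/-- Conjugating the slice of q to ℂ and taking the first coordinate gives a scalar holomorphic
function. The projection does not increase norms, so a lower bound for it is one for f; it fixes
reals, so the derivative a is kept. -/
theorem IsSliceHolomorphic.mul_le_norm (hf : IsSliceHolomorphic f)
    (hb : ∀ q, ‖q‖ < 1 → ‖f q‖ ≤ 1) (h0 : f 0 = 0) {a : ℝ} (ha : a ∈ Ioo (0 : ℝ) 1)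
    (h1 : HasDerivAt (fun x : ℝ => f (x : ℍ)) (a : ℍ) 0) {q : ℍ} (hq : ‖q‖ < 1) :
    ‖q‖ * (a - ‖q‖) ≤ ‖f q‖ * (1 - a * ‖q‖) := by
  set K := unitOf q with hKdef
  have hK : K ∈ imagUnits := unitOf_mem q
  obtain ⟨h, hne, hh⟩ := exists_conj_I hK
  have hn : ‖h‖ ≠ 0 := norm_ne_zero_iff.mpr hne
  set L : ℍ →L[ℝ] ℂ := fstCoord.comp ((ContinuousLinearMap.mul ℝ ℍ h).comp
    ((ContinuousLinearMap.mul ℝ ℍ).flip h⁻¹)) with hL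
  have hLa : ∀ v, L v = fstCoord (h * (v * h⁻¹)) := fun v => rfl
  have hLn : ∀ v, ‖L v‖ ≤ ‖v‖ := by
    intro v
    rw [hLa]
    refine (norm_fstCoord_le _).trans_eq ?_
    rw [norm_mul, norm_mul, norm_inv]
    field_simp
  have hLK : ∀ v, L (K * v) = Complex.I * L v := by
    intro v
    rw [hLa, hLa, mul_assoc, ← mul_assoc h, hh, mul_assoc, fstCoord_coe_mul]
  have hLr : ∀ x : ℝ, L (x : ℍ) = x := by
    intro x
    rw [hLa, ← mul_assoc, ← Quaternion.coe_commutes, mul_assoc, mul_inv_cancel₀ hne, mul_one]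
    apply Complex.ext <;> simp [fstCoord_apply]
  have hd := hf K hK L hLK
  set φ : ℂ → ℂ := fun z => L (f (sliceMap K z)) with hφ
  have hφb : ∀ x ∈ ball (0 : ℂ) 1, ‖φ x‖ ≤ 1 := by
    intro x hx
    refine (hLn _).trans (hb _ ?_)
    rw [norm_sliceMap hK]; simpa using hx
  have hs0 : sliceMap K 0 = 0 := by simpa using sliceMap_ofReal K 0
  have hφ0 : φ 0 = 0 := by simp [hφ, hs0, h0]
  have hφ1 : deriv φ 0 = a := by
    have e1 : HasDerivAt φ (deriv φ 0) ((0 : ℝ) : ℂ) := by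
      rw [Complex.ofReal_zero]
      exact (hd.differentiableAt (isOpen_ball.mem_nhds (mem_ball_self one_pos))).hasDerivAt
    have e2 := e1.comp_ofReal
    have e3 := L.hasFDerivAt.comp_hasDerivAt (0 : ℝ) h1
    have e4 : (fun x : ℝ => φ x) = L ∘ fun x : ℝ => f (x : ℍ) := by
      funext x; simp [hφ, sliceMap_ofReal]
    rw [e4] at e2
    rw [e2.unique e3, hLr]
  have hz : ‖coordOf q‖ = ‖q‖ := norm_coordOf q
  have main := mul_le_norm_of_deriv_eq hd hφb hφ0 ha hφ1 (z := coordOf q) (by rwa [hz])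
  rw [hz] at main
  refine main.trans ?_
  have : ‖φ (coordOf q)‖ ≤ ‖f q‖ := by
    rw [hφ, hKdef]
    simp only [sliceMap_unitOf]
    exact hLn _
  have h2 : 0 ≤ 1 - a * ‖q‖ := by nlinarith [ha.1, ha.2, norm_nonneg q]
  gcongr

/-- The radius `ρ = a / (1 + √(1 - a²))` enters through the equation `a (1 + ρ²) = 2 ρ`. -/
theorem IsSliceHolomorphic.mul_radius_le_norm (hf : IsSliceHolomorphic f)
    (hb : ∀ q, ‖q‖ < 1 → ‖f q‖ ≤ 1) (h0 : f 0 = 0) {a ρ : ℝ} (ha : a ∈ Ioo (0 : ℝ) 1)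
    (hρ : ρ ∈ Ioo (0 : ℝ) 1) (haρ : a * (1 + ρ ^ 2) = 2 * ρ)
    (h1 : HasDerivAt (fun x : ℝ => f (x : ℍ)) (a : ℍ) 0) {q : ℍ} (hq : ‖q‖ ≤ ρ) :
    ‖q‖ * ρ ≤ ‖f q‖ := by
  have main := hf.mul_le_norm hb h0 ha h1 (hq.trans_lt hρ.2)
  set x := ‖q‖
  have hx : 0 ≤ x := norm_nonneg q
  have hpos : 0 < 1 - a * x := by nlinarith [ha.1, ha.2, hρ.2]
  -- The quotient (a - x)/(1 - a x) decreases in x and equals ρ at x = ρ.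
  have key : ρ * (1 - a * x) ≤ a - x := by
    have e : (a - x - ρ * (1 - a * x)) * (1 + ρ ^ 2) = (ρ - x) * (1 - ρ ^ 2) := by
      linear_combination (1 + ρ * x) * haρ
    have e2 : 0 ≤ (ρ - x) * (1 - ρ ^ 2) :=
      mul_nonneg (by linarith) (by nlinarith [hρ.1, hρ.2])
    rw [← e] at e2
    have := nonneg_of_mul_nonneg_left e2 (by positivity)
    linarith
  refine le_of_mul_le_mul_right ?_ hpos
  calc x * ρ * (1 - a * x) = x * (ρ * (1 - a * x)) := by ring
    _ ≤ x * (a - x) := by gcongr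
    _ ≤ _ := main

/-- A collision with q ≠ 0 would give ρ|q| ≤ |f(q)| ≤ |q||q'| < ρ|q|. -/
theorem IsSliceHolomorphic.injOn_ball (hf : IsSliceHolomorphic f)
    (hb : ∀ q, ‖q‖ < 1 → ‖f q‖ < 1) (h0 : f 0 = 0) {a ρ : ℝ} (ha : a ∈ Ioo (0 : ℝ) 1)
    (hρ : ρ ∈ Ioo (0 : ℝ) 1) (haρ : a * (1 + ρ ^ 2) = 2 * ρ)
    (h1 : HasDerivAt (fun x : ℝ => f (x : ℍ)) (a : ℍ) 0) : InjOn f (ball 0 ρ) := by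
  have lower : ∀ q, ‖q‖ < ρ → ‖q‖ * ρ ≤ ‖f q‖ := fun q hq =>
    hf.mul_radius_le_norm (fun q hq => (hb q hq).le) h0 ha hρ haρ h1 hq.le
  have nz : ∀ q, ‖q‖ < ρ → f q = 0 → q = 0 := by
    intro q hq h
    have := lower q hq
    rw [h, norm_zero] at this
    rw [← norm_eq_zero]
    nlinarith [norm_nonneg q, hρ.1]
  intro q hq q' hq' h
  rw [mem_ball_zero_iff] at hq hq'
  by_contra hne
  by_cases hq0 : q = 0
  · rw [hq0, h0] at h
    exact hne (hq0.trans (nz q' hq' h.symm).symm)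
  · have e1 := hf.norm_value_le hb h0 (hq.trans hρ.2) (hq'.trans hρ.2) hne h
    have e2 := lower q hq
    have : 0 < ‖q‖ := norm_pos_iff.mpr hq0
    nlinarith

theorem IsSliceHolomorphic.ball_subset_image (hf : IsSliceHolomorphic f)
    (hb : ∀ q, ‖q‖ < 1 → ‖f q‖ < 1) (h0 : f 0 = 0) {a ρ : ℝ} (ha : a ∈ Ioo (0 : ℝ) 1)
    (hρ : ρ ∈ Ioo (0 : ℝ) 1) (haρ : a * (1 + ρ ^ 2) = 2 * ρ)
    (h1 : HasDerivAt (fun x : ℝ => f (x : ℍ)) (a : ℍ) 0) :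
    ball 0 (ρ ^ 2) ⊆ f '' ball 0 ρ := by
  intro w hw
  rw [mem_ball_zero_iff] at hw
  obtain ⟨q, hq, hqw⟩ := hf.exists_value hρ (c := ρ ^ 2) (fun q hq => by
    have := hf.mul_radius_le_norm (fun q hq => (hb q hq).le) h0 ha hρ haρ h1 hq.le
    rwa [hq, ← sq] at this) h0 hw
  exact ⟨q, by simpa using hq, hqw⟩

/-! ### Growth of functions in the Bergman space -/

theorem two_pi_mul_enorm_le_lintegral_circle {φ : ℂ → ℂ} {c : ℂ} {s : ℝ}
    (hs : 0 ≤ s) (hφ : DiffContOnCl ℂ φ (ball c s)) :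
    ENNReal.ofReal (2 * Real.pi) * ‖φ c‖ₑ ≤
      ∫⁻ θ in Ioo (-Real.pi) Real.pi, ‖φ (circleMap c s θ)‖ₑ := by
  have h1 : Real.circleAverage φ c s = φ c :=
    DiffContOnCl.circleAverage (by rwa [abs_of_nonneg hs])
  have h2 : ∫ θ in (-Real.pi)..Real.pi, φ (circleMap c s θ) = (2 * Real.pi) • φ c := by
    rw [← h1, Real.circleAverage_def, smul_smul, mul_inv_cancel₀ (by positivity), one_smul]
    have hper : Function.Periodic (fun θ => φ (circleMap c s θ)) (2 * Real.pi) := fun θ => by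
      simp only [periodic_circleMap c s θ]
    have := hper.intervalIntegral_add_eq (-Real.pi) 0
    rwa [zero_add, show -Real.pi + 2 * Real.pi = Real.pi by ring] at this
  rw [intervalIntegral.integral_of_le (by linarith [Real.pi_pos]),
    integral_Ioc_eq_integral_Ioo] at h2
  have h3 := enorm_integral_le_lintegral_enorm (μ := volume.restrict (Ioo (-Real.pi) Real.pi))
    (fun θ => φ (circleMap c s θ))
  rw [h2, enorm_smul, Real.enorm_of_nonneg (by positivity)] at h3
  exact h3

/-- The mean value inequality on discs. -/
theorem ofReal_mul_enorm_le_lintegral_ball {φ : ℂ → ℂ} {c : ℂ} {s : ℝ} (hs : 0 < s)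
    (hφ : DifferentiableOn ℂ φ (ball c s)) :
    ENNReal.ofReal (Real.pi * s ^ 2) * ‖φ c‖ₑ ≤ ∫⁻ z in ball c s, ‖φ z‖ₑ := by
  classical
  -- φ is arbitrary off the disc; extension by 0 gives a measurable function on the plane, as polar
  -- coordinates and Tonelli require.
  set u : ℂ → ℝ≥0∞ := (ball c s).piecewise (fun z => ‖φ z‖ₑ) (fun _ => 0) with hu
  have hmeas : Measurable u :=
    hφ.continuousOn.enorm.measurable_piecewise continuousOn_const measurableSet_ball
  have hball : ∫⁻ z in ball c s, ‖φ z‖ₑ = ∫⁻ z, u z := by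
    rw [← lintegral_indicator measurableSet_ball, ← piecewise_eq_indicator]
    rfl
  have hcirc : ∀ p : ℝ × ℝ, c + Complex.polarCoord.symm p = circleMap c p.1 p.2 := by
    intro p
    rw [Complex.polarCoord_symm_apply, circleMap, Complex.exp_mul_I, Complex.ofReal_cos,
      Complex.ofReal_sin]
  have hpolar : ∫⁻ z, u z = ∫⁻ x in Ioi (0 : ℝ), ∫⁻ θ in Ioo (-Real.pi) Real.pi,
      ENNReal.ofReal x * u (circleMap c x θ) := by
    rw [← lintegral_add_left_eq_self u c, ← Complex.lintegral_comp_polarCoord_symm]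
    simp only [hcirc, smul_eq_mul]
    rw [polarCoord_target, Measure.volume_eq_prod, setLIntegral_prod]
    refine Measurable.aemeasurable ?_
    refine (ENNReal.measurable_ofReal.comp measurable_fst).mul (hmeas.comp ?_)
    unfold circleMap
    fun_prop
  have hslice : ∀ x ∈ Ioo (0 : ℝ) s, ENNReal.ofReal x * (ENNReal.ofReal (2 * Real.pi) * ‖φ c‖ₑ) ≤
      ∫⁻ θ in Ioo (-Real.pi) Real.pi, ENNReal.ofReal x * u (circleMap c x θ) := by
    intro x hx
    rw [lintegral_const_mul' _ _ ENNReal.ofReal_ne_top]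
    gcongr
    refine (two_pi_mul_enorm_le_lintegral_circle hx.1.le
      (hφ.diffContOnCl_ball (closedBall_subset_ball hx.2))).trans_eq (lintegral_congr fun θ => ?_)
    have hmem : circleMap c x θ ∈ ball c s :=
      closedBall_subset_ball hx.2 (circleMap_mem_closedBall c hx.1.le θ)
    rw [hu, piecewise_eq_of_mem _ _ _ hmem]
  have hlin : ∫⁻ x in Ioo (0 : ℝ) s, ENNReal.ofReal x = ENNReal.ofReal (s ^ 2 / 2) := by
    have hint : IntegrableOn (fun x : ℝ => x) (Ioo 0 s) :=
      (continuous_id.integrableOn_Icc).mono_set Ioo_subset_Icc_self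
    rw [← ofReal_integral_eq_lintegral_ofReal hint
      ((ae_restrict_mem measurableSet_Ioo).mono fun x hx => hx.1.le),
      ← integral_Ioc_eq_integral_Ioo, ← intervalIntegral.integral_of_le hs.le, integral_id]
    simp
  rw [hball, hpolar]
  calc ENNReal.ofReal (Real.pi * s ^ 2) * ‖φ c‖ₑ
      = ENNReal.ofReal (s ^ 2 / 2) * (ENNReal.ofReal (2 * Real.pi) * ‖φ c‖ₑ) := by
        rw [← mul_assoc, ← ENNReal.ofReal_mul (by positivity)]
        congr 2
        ring
    _ = ∫⁻ x in Ioo (0 : ℝ) s,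
          ENNReal.ofReal x * (ENNReal.ofReal (2 * Real.pi) * ‖φ c‖ₑ) := by
        rw [lintegral_mul_const' _ _ (ENNReal.mul_ne_top ENNReal.ofReal_ne_top enorm_ne_top), hlin]
    _ ≤ ∫⁻ x in Ioo (0 : ℝ) s, ∫⁻ θ in Ioo (-Real.pi) Real.pi,
          ENNReal.ofReal x * u (circleMap c x θ) :=
        setLIntegral_mono' measurableSet_Ioo hslice
    _ ≤ _ := lintegral_mono_set Ioo_subset_Ioi_self

/-- The disc has normalised area s², so the mean value inequality and Hölder give s²|φ(c)| ≤ (s²)^(1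
- 1/p). -/
theorem enorm_le_of_lintegral_le {φ : ℂ → ℂ} {c : ℂ} {s p : ℝ} (hp : 1 ≤ p) (hs : 0 < s)
    (hφ : DifferentiableOn ℂ φ (ball c s))
    (hb : (∫⁻ z in ball c s, ‖φ z‖ₑ ^ p ∂normalizedArea) ^ (1 / p) ≤ 1) :
    ‖φ c‖ ≤ s ^ (-2 / p) := by
  have hp0 : 0 < p := by linarith
  set ν := normalizedArea.restrict (ball c s) with hν
  have hνu : ν univ = ENNReal.ofReal (s ^ 2) := by
    rw [hν, Measure.restrict_apply_univ, normalizedArea, Measure.smul_apply, Complex.volume_ball,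
      smul_eq_mul, ENNReal.ofReal_pow hs.le, mul_comm, mul_assoc, ← ENNReal.ofReal_coe_nnreal,
      ← ENNReal.ofReal_mul (by positivity)]
    simp [Real.pi_ne_zero]
  have hmeas : AEStronglyMeasurable φ ν :=
    hφ.continuousOn.aestronglyMeasurable measurableSet_ball
  have h1 := eLpNorm_le_eLpNorm_mul_rpow_measure_univ (p := 1) (q := ENNReal.ofReal p) (μ := ν)
    (by rw [← ENNReal.ofReal_one]; exact ENNReal.ofReal_le_ofReal hp) hmeas
  rw [eLpNorm_one_eq_lintegral_enorm, eLpNorm_eq_lintegral_rpow_enorm_toReal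
    (by simpa using hp0) ENNReal.ofReal_ne_top, ENNReal.toReal_ofReal hp0.le, hνu,
    ENNReal.toReal_one] at h1
  have h2 : ENNReal.ofReal (s ^ 2) * ‖φ c‖ₑ ≤ ∫⁻ z, ‖φ z‖ₑ ∂ν := by
    have := ofReal_mul_enorm_le_lintegral_ball hs hφ
    rw [hν, normalizedArea, Measure.restrict_smul, lintegral_smul_measure, smul_eq_mul]
    calc ENNReal.ofReal (s ^ 2) * ‖φ c‖ₑ
        = ENNReal.ofReal (1 / Real.pi) * (ENNReal.ofReal (Real.pi * s ^ 2) * ‖φ c‖ₑ) := by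
          rw [← mul_assoc, ← ENNReal.ofReal_mul (by positivity)]
          congr 2
          field_simp
      _ ≤ _ := by gcongr
  have h3 : ENNReal.ofReal (s ^ 2) * ‖φ c‖ₑ ≤ ENNReal.ofReal (s ^ 2) ^ (1 / 1 - 1 / p) := by
    refine h2.trans (h1.trans ?_)
    calc _ ≤ 1 * ENNReal.ofReal (s ^ 2) ^ (1 / 1 - 1 / p) := by gcongr
      _ = _ := one_mul _
  rw [ENNReal.ofReal_rpow_of_pos (by positivity), ← ofReal_norm,
    ← ENNReal.ofReal_mul (by positivity), ENNReal.ofReal_le_ofReal_iff (by positivity)] at h3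
  have h4 : s ^ 2 * s ^ (-2 / p) = (s ^ 2) ^ (1 / 1 - 1 / p) := by
    rw [← Real.rpow_natCast s 2, ← Real.rpow_add hs, ← Real.rpow_mul hs.le]
    congr 1
    push_cast
    ring
  rw [← h4] at h3
  exact le_of_mul_le_mul_left h3 (by positivity)

/-- Point evaluations on the unit ball of the Bergman space. -/
theorem norm_le_rpow_of_bergmanNorm_le_one {f : ℍ → ℍ} {p : ℝ} (hp : 1 ≤ p)
    (hf : IsSliceHolomorphic f) (hn : bergmanNorm p f ≤ 1) {q : ℍ} (hq : ‖q‖ < 1) :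
    ‖f q‖ ≤ (1 - ‖q‖) ^ (-2 / p) := by
  have hp0 : 0 < p := by linarith
  by_cases hw : f q = 0
  · rw [hw, norm_zero]
    exact Real.rpow_nonneg (by linarith) _
  have hwn : ‖f q‖ ≠ 0 := norm_ne_zero_iff.mpr hw
  set K := unitOf q with hKdef
  have hK : K ∈ imagUnits := unitOf_mem q
  obtain ⟨h, hne, hh⟩ := exists_conj_I hK
  have hn' : ‖h‖ ≠ 0 := norm_ne_zero_iff.mpr hne
  set m : ℍ := (f q)⁻¹ * (‖f q‖ : ℝ) with hm
  have hmn : ‖m‖ = 1 := by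
    rw [hm, norm_mul, norm_inv, Quaternion.norm_coe, norm_norm, inv_mul_cancel₀ hwn]
  have hqm : f q * m = ((‖f q‖ : ℝ) : ℍ) := by
    rw [hm, ← mul_assoc, mul_inv_cancel₀ hw, one_mul]
  -- The twist by m ensures L (f q) = |f(q)|, so nothing is lost at q, while |L v| ≤ |v| elsewhere.
  set L : ℍ →L[ℝ] ℂ := fstCoord.comp ((ContinuousLinearMap.mul ℝ ℍ h).comp
    ((ContinuousLinearMap.mul ℝ ℍ).flip (m * h⁻¹))) with hL
  have hLa : ∀ v, L v = fstCoord (h * (v * (m * h⁻¹))) := fun v => rfl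
  have hLn : ∀ v, ‖L v‖ ≤ ‖v‖ := by
    intro v
    rw [hLa]
    refine (norm_fstCoord_le _).trans_eq ?_
    rw [norm_mul, norm_mul, norm_mul, norm_inv, hmn]
    field_simp
  have hLK : ∀ v, L (K * v) = Complex.I * L v := by
    intro v
    rw [hLa, hLa, mul_assoc, ← mul_assoc h, hh, mul_assoc, fstCoord_coe_mul]
  have hLq : L (f q) = ‖f q‖ := by
    rw [hLa, ← mul_assoc (f q), hqm, ← mul_assoc, ← Quaternion.coe_commutes, mul_assoc,
      mul_inv_cancel₀ hne, mul_one]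
    apply Complex.ext <;> simp [fstCoord_apply]
  have hd := hf K hK L hLK
  have hz : ‖coordOf q‖ = ‖q‖ := norm_coordOf q
  have hsub : ball (coordOf q) (1 - ‖q‖) ⊆ ball 0 1 :=
    ball_subset_ball' (by rw [dist_zero_right, hz]; linarith)
  have main := enorm_le_of_lintegral_le hp (sub_pos.mpr hq) (hd.mono hsub) (by
    refine le_trans ?_ ((le_iSup₂ (f := fun I (_ : I ∈ imagUnits) =>
      (∫⁻ z in slicePart I (ball 0 1), ‖sliceRestrict I f z‖ₑ ^ p ∂normalizedArea) ^ (1 / p))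
        K hK).trans hn)
    refine ENNReal.rpow_le_rpow ?_ (by positivity)
    rw [slicePart_ball hK]
    refine (lintegral_mono_set hsub).trans (lintegral_mono fun z => ?_)
    refine ENNReal.rpow_le_rpow ?_ hp0.le
    rw [← ofReal_norm, ← ofReal_norm]
    exact ENNReal.ofReal_le_ofReal (hLn _))
  rw [hKdef, sliceMap_unitOf, hLq] at main
  simpa using main

/-! ### Rescaling to the unit ball and passage to the suprema -/

/-- The real axis lies in every slice, so the derivative along it normalises all slices at once. -/
theorem IsSliceRegularOn.hasDerivAt_zero {f : ℍ → ℍ} (hf : IsSliceRegularOn f (ball 0 1)) :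
    HasDerivAt (fun x : ℝ => f (x : ℍ)) (sliceDeriv f 0) 0 := by
  have hI := coe_I_mem_imagUnits
  set I : ℍ := ((Complex.I : ℂ) : ℍ)
  have hs0 : sliceMap I 0 = 0 := by simpa using sliceMap_ofReal I 0
  have h0 : sliceMap I 0 ∈ ball (0 : ℍ) 1 := by rw [hs0]; exact mem_ball_self one_pos
  have h1 := sliceDeriv_sliceMap isOpen_ball hf hI h0
  rw [derivAlong_eq_deriv isOpen_ball hf hI h0] at h1
  simp only [hs0, zero_add] at h1
  rw [h1]
  refine DifferentiableAt.hasDerivAt ?_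
  have hc := (hf I hI).1
  rw [slicePart_ball hI] at hc
  have hda : DifferentiableAt ℝ (sliceRestrict I f) ((0 : ℝ) : ℂ) := by
    rw [Complex.ofReal_zero]
    exact (hc.contDiffAt (isOpen_ball.mem_nhds (mem_ball_self one_pos))).differentiableAt (by simp)
  have hcomp := hda.comp (0 : ℝ) Complex.ofRealCLM.differentiableAt
  refine hcomp.congr_of_eventuallyEq (Eventually.of_forall fun x => ?_)
  simp [sliceRestrict, sliceMap_ofReal]

/-- The two assertions for a single radius `r`. -/
theorem injOn_and_ball_subset {f : ℍ → ℍ} (hf : IsSliceHolomorphic f) {r M : ℝ}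
    (hr : r ∈ Ioo (0 : ℝ) 1) (hM : 1 ≤ M) (hb : ∀ q, ‖q‖ < r → ‖f q‖ < M) (h0 : f 0 = 0)
    (h1 : HasDerivAt (fun x : ℝ => f (x : ℍ)) 1 0) :
    InjOn f (ball 0 (M - √(M ^ 2 - r ^ 2))) ∧
      ball 0 ((r ^ 2)⁻¹ * M * (M - √(M ^ 2 - r ^ 2)) ^ 2) ⊆
        f '' ball 0 (M - √(M ^ 2 - r ^ 2)) := by
  obtain ⟨hr0, hr1⟩ := hr
  have hM0 : 0 < M := by linarith
  have hs := Real.sq_sqrt (show 0 ≤ M ^ 2 - r ^ 2 by nlinarith)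
  have hs0 := Real.sqrt_nonneg (M ^ 2 - r ^ 2)
  set s := √(M ^ 2 - r ^ 2)
  -- The smaller root of a(1 + ρ²) = 2ρ for a = r/M.
  set ρ := (M - s) / r with hρdef
  have hrρ : M - s = r * ρ := by rw [hρdef]; field_simp
  have hsM : s < M := by nlinarith
  have hMs : M - r < s := by nlinarith
  have hρ : ρ ∈ Ioo (0 : ℝ) 1 :=
    ⟨div_pos (by linarith) hr0, (div_lt_one hr0).mpr (by linarith)⟩
  have ha : r / M ∈ Ioo (0 : ℝ) 1 := ⟨by positivity, (div_lt_one hM0).mpr (by linarith)⟩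
  have haρ : r / M * (1 + ρ ^ 2) = 2 * ρ := by
    rw [hρdef]
    field_simp
    linear_combination hs
  have hcov : (r ^ 2)⁻¹ * M * (M - s) ^ 2 = M * ρ ^ 2 := by
    rw [hρdef]; field_simp
  rw [hcov, hrρ]
  set m : ℍ := ((M⁻¹ : ℝ) : ℍ) with hm
  have hmn : ‖m‖ = M⁻¹ := by rw [hm, Quaternion.norm_coe, Real.norm_of_nonneg (by positivity)]
  have hm0 : m ≠ 0 := by rw [← norm_ne_zero_iff, hmn]; positivity
  have hrn : ‖(r : ℍ)‖ = r := by rw [Quaternion.norm_coe, Real.norm_of_nonneg hr0.le]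
  have hrh : (r : ℍ) ≠ 0 := by rw [← norm_ne_zero_iff, hrn]; exact hr0.ne'
  set g : ℍ → ℍ := fun q => f ((r : ℍ) * q) * m with hg
  have hgH : IsSliceHolomorphic g := hf.comp_mul ⟨hr0, hr1.le⟩ m
  have hgb : ∀ q, ‖q‖ < 1 → ‖g q‖ < 1 := by
    intro q hq
    rw [hg]
    simp only [norm_mul, hmn]
    rw [← div_eq_mul_inv, div_lt_one hM0]
    apply hb
    rw [norm_mul, hrn]
    nlinarith
  have hg0 : g 0 = 0 := by simp [hg, h0]
  have hg1 : HasDerivAt (fun x : ℝ => g (x : ℍ)) ((r / M : ℝ) : ℍ) 0 := by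
    have e1 : HasDerivAt (fun x : ℝ => r * x) r 0 := by
      simpa using (hasDerivAt_id (0 : ℝ)).const_mul r
    have e2 : HasDerivAt (fun x : ℝ => f (x : ℍ)) 1 (r * 0) := by rwa [mul_zero]
    have e3 := (e2.scomp (0 : ℝ) e1).mul_const m
    have e4 : (fun x : ℝ => g (x : ℍ)) =
        fun x => ((fun x : ℝ => f (x : ℍ)) ∘ fun x => r * x) x * m := by
      funext x; simp [hg]
    have e5 : ((r / M : ℝ) : ℍ) = r • (1 : ℍ) * m := by
      rw [hm, smul_mul_assoc, one_mul, ← Quaternion.coe_smul, smul_eq_mul, div_eq_mul_inv]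
    rw [e4, e5]
    exact e3
  constructor
  · have inj := hgH.injOn_ball hgb hg0 ha hρ haρ hg1
    have mem : ∀ q ∈ ball (0 : ℍ) (r * ρ), (r : ℍ)⁻¹ * q ∈ ball (0 : ℍ) ρ := by
      intro q hq
      rw [mem_ball_zero_iff] at hq ⊢
      rw [norm_mul, norm_inv, hrn, inv_mul_lt_iff₀ hr0]
      exact hq
    intro q hq q' hq' h
    have := inj (mem q hq) (mem q' hq') (by
      simp only [hg]
      rw [mul_inv_cancel_left₀ hrh, mul_inv_cancel_left₀ hrh, h])
    exact mul_left_cancel₀ (inv_ne_zero hrh) this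
  · intro w hw
    rw [mem_ball_zero_iff] at hw
    obtain ⟨q, hq, hqw⟩ := hgH.ball_subset_image hgb hg0 ha hρ haρ hg1
      (show w * m ∈ ball 0 (ρ ^ 2) by
        rw [mem_ball_zero_iff, norm_mul, hmn, ← div_eq_mul_inv, div_lt_iff₀ hM0, mul_comm]
        exact hw)
    refine ⟨(r : ℍ) * q, ?_, mul_right_cancel₀ hm0 hqw⟩
    rw [mem_ball_zero_iff] at hq ⊢
    rw [norm_mul, hrn]
    gcongr

theorem injOn_and_ball_covTerm_subset {p : ℝ} (hp : 1 ≤ p) {f : ℍ → ℍ}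
    (hf : IsSliceRegularOn f (ball 0 1)) (hf0 : f 0 = 0) (hf1 : sliceDeriv f 0 = 1)
    (hnorm : bergmanNorm p f ≤ 1) {r : ℝ} (hr : r ∈ Ioo (0 : ℝ) 1) :
    InjOn f (ball 0 (injTerm p r)) ∧ ball 0 (covTerm p r) ⊆ f '' ball 0 (injTerm p r) := by
  have hp0 : 0 < p := by linarith
  have hneg : -2 / p < 0 := div_neg_of_neg_of_pos (by norm_num) hp0
  have hM : 1 ≤ (1 - r) ^ (-2 / p) :=
    Real.one_le_rpow_of_pos_of_le_one_of_nonpos (by linarith [hr.2]) (by linarith [hr.1]) hneg.le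
  have hM2 : (1 - r) ^ (-4 / p) = ((1 - r) ^ (-2 / p)) ^ 2 := by
    rw [← Real.rpow_natCast, ← Real.rpow_mul (by linarith [hr.2])]
    congr 1
    push_cast
    ring
  have hd := hf.hasDerivAt_zero
  rw [hf1] at hd
  rw [injTerm, covTerm, hM2]
  refine injOn_and_ball_subset hf.isSliceHolomorphic hr hM (fun q hq => ?_) hf0 hd
  refine (norm_le_rpow_of_bergmanNorm_le_one hp hf.isSliceHolomorphic hnorm
    (hq.trans hr.2)).trans_lt ?_
  -- Strictness comes from |q| < r and the negative exponent.
  exact Real.rpow_lt_rpow_of_neg (by linarith [hr.2]) (by linarith) hneg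

end SliceRegular

theorem theorem1p3 (p : ℝ) (hp : 1 ≤ p) (f : ℍ → ℍ)
    (hf : f ∈ SliceRegular.bergmanSpace p)
    (hf0 : f 0 = 0) (hf1 : SliceRegular.sliceDeriv f 0 = 1)
    (hnorm : SliceRegular.bergmanNorm p f ≤ 1) :
    InjOn f (ball (0 : ℍ) (SliceRegular.injRadius p)) ∧
      ball (0 : ℍ) (SliceRegular.covRadius p) ⊆
        f '' ball (0 : ℍ) (SliceRegular.injRadius p) := by
  have main := fun r (hr : r ∈ Ioo (0 : ℝ) 1) =>
    SliceRegular.injOn_and_ball_covTerm_subset hp hf.1 hf0 hf1 hnorm hr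
  constructor
  · intro q hq q' hq' h
    rw [mem_ball_zero_iff] at hq hq'
    -- The balls are concentric, so a single r contains both points even if the supremum is not
    -- attained.
    obtain ⟨_, ⟨r, hr, rfl⟩, hlt⟩ :=
      (lt_isLUB_iff (SliceRegular.isLUB_injRadius hp)).mp (max_lt hq hq')
    exact (main r hr).1 (by simpa using (le_max_left _ _).trans_lt hlt)
      (by simpa using (le_max_right _ _).trans_lt hlt) h
  · intro w hw
    rw [mem_ball_zero_iff] at hw
    obtain ⟨_, ⟨r, hr, rfl⟩, hlt⟩ :=
      (lt_isLUB_iff (SliceRegular.isLUB_covRadius hp)).mp hw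
    obtain ⟨q, hq, hqw⟩ := (main r hr).2 (by simpa using hlt)
    -- The r chosen for covering need not be nearly optimal for injectivity; its ball still lies in
    -- the one of radius r_p.
    exact ⟨q, ball_subset_ball ((SliceRegular.isLUB_injRadius hp).1 ⟨r, hr, rfl⟩) hq, hqw⟩
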